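/- Let $M_1$ and $M_2$ be compact connected (Hausdorff) complex manifolds. For a complex manifold $M$, let $\mathcal H(M)$ be the cone of smooth Hermitian metrics on $M$ with nonpositive holomorphic bisectional curvature, i.e. whose Chern connection has curvature satisfying $R(u,\bar u,v,\bar v)\le 0$ for all tangent vectors $u,v$ of type $(1,0)$, where in local holomorphic coordinates $$R_{i\bar j k\bar l}=-\partial_k\partial_{\bar l}h_{i\bar j}+\sum_{a,b} h^{\bar b a}\,\partial_k h_{i\bar b}\,\partial_{\bar l}h_{a\bar j}.$$ Let $h^{1,0}(M)=\dim_{\mathbb C}H^{1,0}(M)$ be the dimension of the space of holomorphic $1$-forms on $M$. Suppose that $\mathcal H(M_1)\neq\emptyset$ and $\mathcal H(M_2)\neq\emptyset$. Then $(h_1,h_2)\mapsto \pi_1^*h_1+\pi_2^*h_2$ is injective and maps $\mathcal H(M_1)\times\mathcal H(M_2)$ into $\mathcal H(M_1\times M_2)$; the numbers $h^{1,0}(M_1)$ and $h^{1,0}(M_2)$ are finite; and, identifying $\mathcal H(M_1)\times\mathcal H(M_2)$ with its image, the real vector space $\langle\mathcal H(M_1)\times\mathcal H(M_2)\rangle_{\mathbb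 R}$ spanned by it has finite codimension in the real vector space $\langle\mathcal H(M_1\times M_2)\rangle_{\mathbb R}$ spanned by $\mathcal H(M_1\times M_2)$, namely $$\dim_{\mathbb R}\Big(\langle\mathcal H(M_1\times M_2)\rangle_{\mathbb R}\big/\langle\mathcal H(M_1)\times\mathcal H(M_2)\rangle_{\mathbb R}\Big)=2\,h^{1,0}(M_1)\,h^{1,0}(M_2).$$ -/

import Mathlib

open scoped Manifold ContDiff

noncomputable section

namespace HermitianProduct

variable {E H : Type*} [NormedAddCommGroup E] [NormedSpace ℂ E] [TopologicalSpace H]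

/-- The holomorphic coordinate frame of the preferred chart at `p`: it sends a constant vector
`u : E` to the coordinate vector field with components `u`, at the point with coordinates `z`.
The complex tangent space `TangentSpace I x` plays the role of `T^{1,0}_x M`.
(All models `I` used below are without boundary.) -/
def coordVec (I : ModelWithCorners ℂ E H) {M : Type*} [TopologicalSpace M] [ChartedSpace H M]
    (p : M) (z : E) : E →L[ℂ] TangentSpace I ((extChartAt I p).symm z) :=
  mfderiv 𝓘(ℂ, E) I (extChartAt I p).symm z

/-- Fields of sesquilinear forms on the tangent spaces (linear in the first variable,
conjugate-linear in the second), with no regularity. -/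
def SesqField (I : ModelWithCorners ℂ E H) (M : Type*) [TopologicalSpace M]
    [ChartedSpace H M] : Type _ :=
  ∀ x : M, TangentSpace I x →ₗ[ℂ] TangentSpace I x →ₗ⋆[ℂ] ℂ

instance (I : ModelWithCorners ℂ E H) (M : Type*) [TopologicalSpace M] [ChartedSpace H M] :
    AddCommGroup (SesqField I M) :=
  inferInstanceAs (AddCommGroup (∀ x : M, TangentSpace I x →ₗ[ℂ] TangentSpace I x →ₗ⋆[ℂ] ℂ))

instance (I : ModelWithCorners ℂ E H) (M : Type*) [TopologicalSpace M] [ChartedSpace H M] :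
    Module ℝ (SesqField I M) :=
  inferInstanceAs (Module ℝ (∀ x : M, TangentSpace I x →ₗ[ℂ] TangentSpace I x →ₗ⋆[ℂ] ℂ))

/-- The component `h_{u v̄}(z)` of `h` in the preferred chart at `p`. -/
def comp {I : ModelWithCorners ℂ E H} {M : Type*} [TopologicalSpace M] [ChartedSpace H M]
    (h : SesqField I M) (p : M) (u v : E) (z : E) : ℂ :=
  h ((extChartAt I p).symm z) (coordVec I p z u) (coordVec I p z v)

/-- The Wirtinger derivative `∂_v f` in the direction `v`. -/
def dHol (v : E) (f : E → ℂ) (z : E) : ℂ :=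
  (1 / 2 : ℂ) * (fderiv ℝ f z v - Complex.I * fderiv ℝ f z (Complex.I • v))

/-- The conjugate Wirtinger derivative `∂_v̄ f` in the direction `v`. -/
def dBar (v : E) (f : E → ℂ) (z : E) : ℂ :=
  (1 / 2 : ℂ) * (fderiv ℝ f z v + Complex.I * fderiv ℝ f z (Complex.I • v))

/-- A smooth Hermitian metric. -/
structure IsHermitianMetric {I : ModelWithCorners ℂ E H} {M : Type*} [TopologicalSpace M]
    [ChartedSpace H M] (h : SesqField I M) : Prop where
  hermitian : ∀ (x : M) (u v : TangentSpace I x), h x u v = starRingEnd ℂ (h x v u)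
  pos : ∀ (x : M) (u : TangentSpace I x), u ≠ 0 → 0 < (h x u u).re
  smooth : ∀ (p : M) (u v : E), ContDiffOn ℝ ∞ (comp h p u v) (extChartAt I p).target

/-- The Gram matrix `(h_{i j̄}(z))` of `h` in the preferred chart at `p`, for a fixed basis of
the model space. -/
def gram [FiniteDimensional ℂ E] {I : ModelWithCorners ℂ E H} {M : Type*} [TopologicalSpace M]
    [ChartedSpace H M] (h : SesqField I M) (p : M) (z : E) :
    Matrix (Fin (Module.finrank ℂ E)) (Fin (Module.finrank ℂ E)) ℂ :=
  Matrix.of fun i j => comp h p (Module.finBasis ℂ E i) (Module.finBasis ℂ E j) z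

/-- The component `R_{a b̄ c d̄}` of the curvature tensor of the Chern connection of `h` at the
point with coordinates `z` in the preferred chart at `p`:
`R_{a b̄ c d̄} = - ∂_c ∂_d̄ h_{a b̄} + ∑ h^{j̄ i} ∂_c h_{a j̄} ∂_d̄ h_{i b̄}`. -/
def chernCurvature [FiniteDimensional ℂ E] {I : ModelWithCorners ℂ E H} {M : Type*}
    [TopologicalSpace M] [ChartedSpace H M] (h : SesqField I M) (p : M) (z : E)
    (a b c d : E) : ℂ :=
  - dHol c (dBar d (comp h p a b)) z
    + ∑ i, ∑ j, (gram h p z)⁻¹ j i * dHol c (comp h p a (Module.finBasis ℂ E j)) z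
        * dBar d (comp h p (Module.finBasis ℂ E i) b) z

/-- Nonpositive holomorphic bisectional curvature: `R(u, ū, v, v̄) ≤ 0` (a real number when `h`
is a Hermitian metric) for all tangent vectors `u`, `v` of type `(1,0)`. -/
def NonposBisectional [FiniteDimensional ℂ E] {I : ModelWithCorners ℂ E H} {M : Type*}
    [TopologicalSpace M] [ChartedSpace H M] (h : SesqField I M) : Prop :=
  ∀ (p : M), ∀ z ∈ (extChartAt I p).target, ∀ u v : E, (chernCurvature h p z u u v v).re ≤ 0

/-- The cone `ℋ(M)` of Hermitian metrics with nonpositive holomorphic bisectional curvature. -/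
def nonposMetrics [FiniteDimensional ℂ E] (I : ModelWithCorners ℂ E H) (M : Type*)
    [TopologicalSpace M] [ChartedSpace H M] : Set (SesqField I M) :=
  {h | IsHermitianMetric h ∧ NonposBisectional h}

/-- The space `H^{1,0}(M)` of holomorphic `1`-forms. -/
def holomorphicOneForms (I : ModelWithCorners ℂ E H) (M : Type*) [TopologicalSpace M]
    [ChartedSpace H M] : Submodule ℂ (∀ x : M, TangentSpace I x →ₗ[ℂ] ℂ) where
  carrier := {φ | ∀ (p : M) (u : E), DifferentiableOn ℂ
    (fun z => φ ((extChartAt I p).symm z) (coordVec I p z u)) (extChartAt I p).target}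
  add_mem' hφ hψ p u := (hφ p u).add (hψ p u)
  zero_mem' _ _ := differentiableOn_const (0 : ℂ)
  smul_mem' c _ hφ p u := (hφ p u).const_smul c

/-- The Hodge number `h^{1,0}(M) = dim_ℂ H^{1,0}(M)`. -/
def hodge10 (I : ModelWithCorners ℂ E H) (M : Type*) [TopologicalSpace M]
    [ChartedSpace H M] : ℕ :=
  Module.finrank ℂ (holomorphicOneForms I M)

/-- The pullback `f^* h`, an `ℝ`-linear function of `h`. -/
def pullback {E' H' : Type*} [NormedAddCommGroup E'] [NormedSpace ℂ E'] [TopologicalSpace H']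
    (I : ModelWithCorners ℂ E H) (J : ModelWithCorners ℂ E' H')
    {M N : Type*} [TopologicalSpace M] [ChartedSpace H M] [TopologicalSpace N]
    [ChartedSpace H' N] (f : M → N) : SesqField J N →ₗ[ℝ] SesqField I M where
  toFun h := fun x => LinearMap.mk₂'ₛₗ (RingHom.id ℂ) (starRingEnd ℂ)
    (fun u v : TangentSpace I x => h (f x) (mfderiv I J f x u) (mfderiv I J f x v))
    (fun u u' v => by rw [map_add, map_add, LinearMap.add_apply])
    (fun c u v => by rw [map_smul, map_smul, LinearMap.smul_apply]; rfl)
    (fun u v v' => by rw [map_add, map_add])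
    (fun c u v => by rw [map_smul, LinearMap.map_smulₛₗ])
  map_add' _ _ := rfl
  map_smul' _ _ := rfl

/-- The map `(h₁, h₂) ↦ π₁^* h₁ + π₂^* h₂`, through which pairs of metrics on the factors are
regarded as metrics on the product. -/
def productField {E' H' : Type*} [NormedAddCommGroup E'] [NormedSpace ℂ E']
    [TopologicalSpace H'] (I : ModelWithCorners ℂ E H) (J : ModelWithCorners ℂ E' H')
    (M N : Type*) [TopologicalSpace M] [ChartedSpace H M] [TopologicalSpace N]
    [ChartedSpace H' N] :
    (SesqField I M × SesqField J N) →ₗ[ℝ] SesqField (I.prod J) (M × N) :=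
  LinearMap.coprod (pullback (I.prod J) I Prod.fst) (pullback (I.prod J) J Prod.snd)

/-- The real vector space spanned by `ℋ(M × N)`. -/
def productSpan {E' H' : Type*} [NormedAddCommGroup E'] [NormedSpace ℂ E']
    [TopologicalSpace H'] [FiniteDimensional ℂ E] [FiniteDimensional ℂ E']
    (I : ModelWithCorners ℂ E H) (J : ModelWithCorners ℂ E' H')
    (M N : Type*) [TopologicalSpace M] [ChartedSpace H M] [TopologicalSpace N]
    [ChartedSpace H' N] : Submodule ℝ (SesqField (I.prod J) (M × N)) :=
  Submodule.span ℝ (nonposMetrics (I.prod J) (M × N))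

/-- The real vector space spanned by `ℋ(M) × ℋ(N)`, placed in the fields on `M × N`. -/
def splitSpan {E' H' : Type*} [NormedAddCommGroup E'] [NormedSpace ℂ E']
    [TopologicalSpace H'] [FiniteDimensional ℂ E] [FiniteDimensional ℂ E']
    (I : ModelWithCorners ℂ E H) (J : ModelWithCorners ℂ E' H')
    (M N : Type*) [TopologicalSpace M] [ChartedSpace H M] [TopologicalSpace N]
    [ChartedSpace H' N] : Submodule ℝ (SesqField (I.prod J) (M × N)) :=
  (Submodule.span ℝ (nonposMetrics I M ×ˢ nonposMetrics J N)).map (productField I J M N)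

end HermitianProduct

end

/-! ### Maximum principles in one complex variable -/

noncomputable section
namespace HermitianProduct

open Set Metric Filter Topology Laplacian InnerProductSpace

/-! The key is that nonpositivity of the curvature of a Hermitian metric can be written linearly in
`h`. With `β(e) = ∂_v̄ h(e, u)`, one has `R(u, ū, v, v̄) = -∂_v∂_v̄ h(u, u) + ‖β‖²`, and the squared
dual norm is the maximum over `e` of `2 Re β(e) - h(e, e)`. So `R ≤ 0` is a family of linear
inequalities indexed by `e` (`nonposBisectional_iff`). They pass to sums, products and slices, and
`φ ⊗ φ̄` satisfies them when `φ` is a holomorphic `1`-form, because there they read `|a - b|² ≥ 0`.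

On `M₁ × M₂`, take `u` along `M₁` and `v` along `M₂`. The choice `e = 0` says that `h(u, u)` is
plurisubharmonic along the compact connected `M₂`, hence constant (`restrictFst_eq`). Now the
right-hand side vanishes, and rescaling `e` forces `∂_v̄ h(e, u) = 0` (`dBar_comp_eq_zero`). Hence
the mixed components are holomorphic `1`-forms on `M₂`, and by Hermitian symmetry conjugates of such
forms on `M₁`. An element of the span whose mixed part vanishes is the sum of its restrictions to
slices, so it is split (`mem_splitSpan_iff`).

Conversely, `h₁ + h₂ + (φ + ψ) ⊗ conj (φ + ψ)` and `(h₁ + φ ⊗ φ̄) + (h₂ + ψ ⊗ ψ̄)` both lie in the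
cone, and the mixed part of their difference is `ψ ⊗ φ̄` (`exists_mixedForm_eq`). The quotient is
therefore `H^{1,0}(M₂) ⊗ conj H^{1,0}(M₁)`, of real dimension `2 h^{1,0}(M₁) h^{1,0}(M₂)`.
Finiteness of these spaces comes from compactness and the Schwarz lemma
(`finite_holomorphicOneForms`). -/

lemma fderiv_fderiv_nonpos_of_isLocalMax {V : Type*} [NormedAddCommGroup V] [NormedSpace ℝ V]
    {g : V → ℝ} {z : V} (hg : ContDiffAt ℝ 2 g z) (hmax : IsLocalMax g z) (v : V) :
    fderiv ℝ (fderiv ℝ g) z v v ≤ 0 := by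
  have hline : ∀ t : ℝ, HasDerivAt (fun t : ℝ => z + t • v) v t := fun t => by
    simpa using ((hasDerivAt_id t).smul_const v).const_add z
  have htend : Tendsto (fun t : ℝ => z + t • v) (𝓝 0) (𝓝 z) := by
    simpa using (hline 0).continuousAt.tendsto
  have hz0 : z = z + (0 : ℝ) • v := by simp
  have hd1 : ∀ᶠ t in 𝓝 (0 : ℝ), HasDerivAt (fun t : ℝ => g (z + t • v))
      (fderiv ℝ g (z + t • v) v) t := by
    filter_upwards [htend.eventually (hg.eventually (by simp))] with t ht
    exact (ht.differentiableAt (by simp)).hasFDerivAt.comp_hasDerivAt t (hline t)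
  have hd2 : HasDerivAt (fun t : ℝ => fderiv ℝ g (z + t • v) v)
      (fderiv ℝ (fderiv ℝ g) z v v) 0 := by
    have h1 : DifferentiableAt ℝ (fderiv ℝ g) z :=
      (hg.fderiv_right (m := 1) (by norm_num)).differentiableAt (by simp)
    have h2 : HasDerivAt (fun t : ℝ => fderiv ℝ g (z + t • v))
        (fderiv ℝ (fderiv ℝ g) z v) 0 :=
      HasFDerivAt.comp_hasDerivAt_of_eq (0 : ℝ) h1.hasFDerivAt (hline 0) hz0
    simpa using h2.clm_apply (hasDerivAt_const (0 : ℝ) v)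
  have hdd : deriv (deriv fun t : ℝ => g (z + t • v)) 0 = fderiv ℝ (fderiv ℝ g) z v v := by
    rw [← hd2.deriv]
    exact Filter.EventuallyEq.deriv_eq (hd1.mono fun t ht => ht.deriv)
  have hm : IsLocalMax (fun t : ℝ => g (z + t • v)) 0 := by
    have := htend.eventually hmax
    filter_upwards [this] with t ht
    simpa using ht
  by_contra hpos
  push Not at hpos
  rw [← hdd] at hpos
  -- A positive second derivative would make the maximum also a local minimum, so `g` would be
  -- locally constant on the line, with zero second derivative.
  have hmin := isLocalMin_of_deriv_deriv_pos hpos hm.deriv_eq_zero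
    (hd1.self_of_nhds.continuousAt)
  have hconst : (fun t : ℝ => g (z + t • v)) =ᶠ[𝓝 0] fun _ => g (z + (0 : ℝ) • v) := by
    filter_upwards [hm, hmin] with t h1 h2 using le_antisymm h1 h2
  have : deriv (fun t : ℝ => g (z + t • v)) =ᶠ[𝓝 0] fun _ => 0 := by
    simpa using hconst.deriv
  rw [this.deriv_eq] at hpos
  simp at hpos

lemma laplacian_nonpos_of_isLocalMax {g : ℂ → ℝ} {z : ℂ} (hg : ContDiffAt ℝ 2 g z)
    (hmax : IsLocalMax g z) : Δ g z ≤ 0 := by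
  rw [laplacian_eq_iteratedFDeriv_complexPlane]
  simp only [iteratedFDeriv_two_apply]
  exact add_nonpos (fderiv_fderiv_nonpos_of_isLocalMax hg hmax _)
    (fderiv_fderiv_nonpos_of_isLocalMax hg hmax _)

lemma laplacian_re_sq (z : ℂ) : Δ (fun z : ℂ => z.re ^ 2) z = 2 := by
  have h1 : fderiv ℝ (fun z : ℂ => z.re ^ 2) = fun z => (2 * z.re) • Complex.reCLM := by
    ext1 z
    have := (Complex.reCLM.hasFDerivAt (x := z)).pow 2
    simpa using this.fderiv
  have h2 : fderiv ℝ (fun z : ℂ => (2 * z.re) • Complex.reCLM) z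
      = ((2 : ℝ) • Complex.reCLM).smulRight Complex.reCLM := by
    have := (((Complex.reCLM.hasFDerivAt (x := z)).const_mul 2).smul_const Complex.reCLM)
    exact this.fderiv
  rw [laplacian_eq_iteratedFDeriv_complexPlane]
  simp only [iteratedFDeriv_two_apply, h1, h2]
  simp

/-- The weak maximum principle for functions with positive Laplacian. -/
lemma exists_sphere_le_of_laplacian_pos {g : ℂ → ℝ} {r : ℝ} (hr : 0 < r)
    (hg : ∀ z ∈ closedBall (0 : ℂ) r, ContDiffAt ℝ 2 g z)
    (hpos : ∀ z ∈ ball (0 : ℂ) r, 0 < Δ g z) : ∃ z ∈ sphere (0 : ℂ) r, g 0 ≤ g z := by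
  obtain ⟨z, hz, hmax⟩ := (isCompact_closedBall (0 : ℂ) r).exists_isMaxOn
    ⟨0, by simp [hr.le]⟩ (fun z hz => (hg z hz).continuousAt.continuousWithinAt)
  refine ⟨z, ?_, hmax (by simp [hr.le])⟩
  by_contra hzs
  have hzb : z ∈ ball (0 : ℂ) r := by
    rw [mem_ball]
    exact lt_of_le_of_ne hz hzs
  have hl : IsLocalMax g z := hmax.isLocalMax
    (mem_of_superset (isOpen_ball.mem_nhds hzb) ball_subset_closedBall)
  exact absurd (laplacian_nonpos_of_isLocalMax (hg z hz) hl) (not_le.mpr (hpos z hzb))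

/-- This is the Poisson kernel with pole `w`, used below as a harmonic barrier. -/
lemma re_add_div_sub (w z : ℂ) :
    ((w + z) / (w - z)).re = (‖w‖ ^ 2 - ‖z‖ ^ 2) / ‖w - z‖ ^ 2 := by
  rw [Complex.div_re, ← add_div, ← Complex.normSq_eq_norm_sq, ← Complex.normSq_eq_norm_sq,
    ← Complex.normSq_eq_norm_sq]
  congr 1
  simp [Complex.normSq_apply]
  ring

/-- The strong maximum principle for functions with nonnegative Laplacian on a disc. -/
lemma eqOn_of_laplacian_nonneg {g : ℂ → ℝ} {R : ℝ} (hg : ContDiffOn ℝ 2 g (ball 0 R))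
    (hlap : ∀ z ∈ ball (0 : ℂ) R, 0 ≤ Δ g z) (hmax : ∀ z ∈ ball (0 : ℂ) R, g z ≤ g 0) :
    ∀ z ∈ ball (0 : ℂ) R, g z = g 0 := by
  intro ζ hζ
  by_contra hne
  have hlt : g ζ < g 0 := lt_of_le_of_ne (hmax ζ hζ) hne
  have hgat : ∀ z ∈ ball (0 : ℂ) R, ContDiffAt ℝ 2 g z := fun z hz =>
    hg.contDiffAt (isOpen_ball.mem_nhds hz)
  have hζ0 : ζ ≠ 0 := fun h => hne (by rw [h])
  set r := ‖ζ‖ with hrdef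
  have hr : 0 < r := norm_pos_iff.mpr hζ0
  have hrR : r < R := by simpa using hζ
  set δ := (g 0 - g ζ) / 2 with hδdef
  have hδ : 0 < δ := by simp only [hδdef]; linarith
  obtain ⟨d, hd, hdδ⟩ : ∃ d > 0, ∀ z, dist z ζ < d → g z < g 0 - δ := by
    have : ∀ᶠ z in 𝓝 ζ, g z < g 0 - δ :=
      (hgat ζ hζ).continuousAt.tendsto.eventually_lt_const (by simp only [hδdef]; linarith)
    exact Metric.eventually_nhds_iff.mp this
  -- The bound `s ≤ 1` gives `2 + s ≤ 3`; `s * r ≤ d / 2` keeps points at distance `d` from `ζ` at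
  -- distance `d / 2` from the pole; the last bound makes the barrier at most `1 / 2` there.
  obtain ⟨s, hs, hs1, hsd, hsd2⟩ : ∃ s > 0, s ≤ 1 ∧ s * r ≤ d / 2 ∧ 24 * (s * r ^ 2) ≤ d ^ 2 := by
    refine ⟨min (min 1 (d / (2 * r))) (d ^ 2 / (24 * r ^ 2)), by positivity, ?_, ?_, ?_⟩
    · exact (min_le_left _ _).trans (min_le_left _ _)
    · have : min (min 1 (d / (2 * r))) (d ^ 2 / (24 * r ^ 2)) ≤ d / (2 * r) :=
        (min_le_left _ _).trans (min_le_right _ _)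
      calc _ ≤ d / (2 * r) * r := by gcongr
        _ = d / 2 := by field_simp
    · have : min (min 1 (d / (2 * r))) (d ^ 2 / (24 * r ^ 2)) ≤ d ^ 2 / (24 * r ^ 2) :=
        min_le_right _ _
      calc _ ≤ 24 * (d ^ 2 / (24 * r ^ 2) * r ^ 2) := by gcongr
        _ = d ^ 2 := by field_simp
  -- The pole sits just outside the circle through `ζ`: the kernel is harmonic on the closed disc,
  -- equals `1` at the centre, and is large on the circle only near `ζ`, where `g` is well below `g
  -- 0`.
  set w : ℂ := ((1 + s : ℝ) : ℂ) * ζ with hw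
  have hwn : ‖w‖ = (1 + s) * r := by
    rw [hw, norm_mul, Complex.norm_real, Real.norm_of_nonneg (by linarith)]
  set u : ℂ → ℝ := fun z => ((w + z) / (w - z)).re with hu
  have hwz : ∀ z ∈ closedBall (0 : ℂ) r, s * r ≤ ‖w - z‖ := fun z hz => by
    have h1 : ‖z‖ ≤ r := by simpa using hz
    have := norm_sub_norm_le w z
    rw [hwn] at this
    linarith
  have hharm : ∀ z ∈ closedBall (0 : ℂ) r, HarmonicAt u z := fun z hz => by
    have hne : w - z ≠ 0 := norm_pos_iff.mp (lt_of_lt_of_le (by positivity) (hwz z hz))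
    have : AnalyticAt ℂ (fun z => (w + z) / (w - z)) z :=
      (analyticAt_const.add analyticAt_id).div (analyticAt_const.sub analyticAt_id) hne
    exact this.harmonicAt_re
  have hnum : ∀ z ∈ sphere (0 : ℂ) r, u z = (s * (2 + s) * r ^ 2) / ‖w - z‖ ^ 2 := fun z hz => by
    have h1 : ‖z‖ = r := by simpa using hz
    simp only [hu, re_add_div_sub, hwn, h1]
    congr 1
    ring
  have hK : ∀ z ∈ sphere (0 : ℂ) r, u z ≤ 3 / s := fun z hz => by
    rw [hnum z hz]
    have h1 := hwz z (sphere_subset_closedBall hz)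
    calc s * (2 + s) * r ^ 2 / ‖w - z‖ ^ 2 ≤ s * (2 + s) * r ^ 2 / (s * r) ^ 2 := by gcongr
      _ = (2 + s) / s := by field_simp
      _ ≤ 3 / s := by gcongr; linarith
  have hfar : ∀ z ∈ sphere (0 : ℂ) r, d ≤ dist z ζ → u z ≤ 1 / 2 := fun z hz hdz => by
    rw [hnum z hz]
    have h2 : ‖w - ζ‖ = s * r := by
      have : w - ζ = (s : ℂ) * ζ := by rw [hw]; push_cast; ring
      rw [this, norm_mul, Complex.norm_real, Real.norm_of_nonneg hs.le]
    have h3 : d / 2 ≤ ‖w - z‖ := by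
      have h4 : dist z ζ ≤ ‖w - z‖ + ‖w - ζ‖ := by
        rw [dist_eq_norm, show z - ζ = -(w - z) + (w - ζ) by ring]
        exact (norm_add_le _ _).trans (by rw [norm_neg])
      linarith
    calc s * (2 + s) * r ^ 2 / ‖w - z‖ ^ 2 ≤ s * 3 * r ^ 2 / (d / 2) ^ 2 := by
          gcongr; linarith
      _ = 12 * (s * r ^ 2) / d ^ 2 := by field_simp; ring
      _ ≤ 1 / 2 := by rw [div_le_iff₀ (by positivity)]; linarith
  have hu0 : u 0 = 1 := by
    have hw0 : w ≠ 0 := norm_pos_iff.mp (by rw [hwn]; positivity)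
    simp [hu, hw0]
  -- This makes `ε` times the maximum `3 / s` of the barrier equal to the gap `δ`.
  set ε := δ * s / 3 with hε
  have hεpos : 0 < ε := by positivity
  set η := ε / (4 * r ^ 2) with hη
  have hηpos : 0 < η := by positivity
  set v : ℂ → ℝ := fun z => z.re ^ 2 with hv
  have hvc : ∀ z, ContDiffAt ℝ 2 v z := fun z =>
    (Complex.reCLM.contDiff.contDiffAt).pow 2
  have hsub : closedBall (0 : ℂ) r ⊆ ball 0 R := closedBall_subset_ball hrR
  -- The term `η • v` makes the Laplacian strictly positive. The centre has value `g 0 + ε`, while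
  -- the circle stays below `g 0 + ε / 4` near `ζ` and at most `g 0 + 3 * ε / 4` elsewhere.
  obtain ⟨z, hz, hle⟩ := exists_sphere_le_of_laplacian_pos (g := g + ε • u + η • v) hr
    (fun z hz => ((hgat z (hsub hz)).add ((hharm z hz).1.const_smul ε)).add
      ((hvc z).const_smul η))
    (fun z hz => by
      have hz' := ball_subset_closedBall hz
      have h1 := hgat z (hsub hz')
      have h2 : ContDiffAt ℝ 2 (ε • u) z := (hharm z hz').1.const_smul ε
      have h12 : ContDiffAt ℝ 2 (g + ε • u) z := h1.add h2
      have h3 : ContDiffAt ℝ 2 (η • v) z := (hvc z).const_smul η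
      rw [h12.laplacian_add h3, h1.laplacian_add h2,
        laplacian_smul _ (hharm z hz').1, laplacian_smul _ (hvc z), (hharm z hz').2.self_of_nhds,
        laplacian_re_sq]
      have := hlap z (hsub hz')
      simp only [Pi.zero_apply, smul_eq_mul, mul_zero]
      positivity)
  simp only [Pi.add_apply, Pi.smul_apply, smul_eq_mul, hu0] at hle
  have hv0 : v 0 = 0 := by simp [hv]
  have hvz : v z ≤ r ^ 2 := by
    have h1 : ‖z‖ = r := by simpa using hz
    have := Complex.abs_re_le_norm z
    rw [h1] at this
    exact sq_le_sq' (abs_le.mp this).1 (abs_le.mp this).2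
  have hηv : η * v z ≤ ε / 4 := by
    calc η * v z ≤ η * r ^ 2 := by gcongr
      _ = ε / 4 := by rw [hη]; field_simp
  rw [hv0, mul_zero, add_zero, mul_one] at hle
  by_cases hdz : dist z ζ < d
  · have h1 := hdδ z hdz
    have h2 : ε * u z ≤ δ := by
      calc ε * u z ≤ ε * (3 / s) := by gcongr; exact hK z hz
        _ = δ := by rw [hε]; field_simp
    linarith
  · have h1 := hfar z hz (not_lt.mp hdz)
    have h2 := hmax z (hsub (sphere_subset_closedBall hz))
    have h3 : ε * u z ≤ ε * (1 / 2) := by gcongr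
    linarith

end HermitianProduct

end

/-! ### Wirtinger calculus and plurisubharmonic functions -/

noncomputable section

namespace HermitianProduct

open Set Metric Filter Topology Laplacian InnerProductSpace ComplexConjugate

section Wirtinger

variable {E : Type*} [NormedAddCommGroup E] [NormedSpace ℂ E]
  {E' : Type*} [NormedAddCommGroup E'] [NormedSpace ℂ E']

lemma dHol_congr {f g : E → ℂ} {z : E} (h : f =ᶠ[𝓝 z] g) (v : E) : dHol v f z = dHol v g z := by
  simp only [dHol, h.fderiv_eq]

lemma dBar_congr {f g : E → ℂ} {z : E} (h : f =ᶠ[𝓝 z] g) (v : E) : dBar v f z = dBar v g z := by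
  simp only [dBar, h.fderiv_eq]

lemma dBar_congr_nhds {f g : E → ℂ} {z : E} (h : f =ᶠ[𝓝 z] g) (v : E) :
    dBar v f =ᶠ[𝓝 z] dBar v g :=
  h.eventuallyEq_nhds.mono fun _ hy => dBar_congr hy v

lemma dHol_dBar_congr {f g : E → ℂ} {z : E} (h : f =ᶠ[𝓝 z] g) (v w : E) :
    dHol v (dBar w f) z = dHol v (dBar w g) z :=
  dHol_congr (dBar_congr_nhds h w) v

@[simp] lemma dHol_const (v : E) (c : ℂ) (z : E) : dHol v (fun _ => c) z = 0 := by simp [dHol]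

@[simp] lemma dBar_const (v : E) (c : ℂ) (z : E) : dBar v (fun _ => c) z = 0 := by simp [dBar]

lemma dHol_add {f g : E → ℂ} {z : E} (hf : DifferentiableAt ℝ f z) (hg : DifferentiableAt ℝ g z)
    (v : E) : dHol v (fun z => f z + g z) z = dHol v f z + dHol v g z := by
  simp only [dHol, fderiv_fun_add hf hg, add_apply]
  ring

lemma dBar_add {f g : E → ℂ} {z : E} (hf : DifferentiableAt ℝ f z) (hg : DifferentiableAt ℝ g z)
    (v : E) : dBar v (fun z => f z + g z) z = dBar v f z + dBar v g z := by
  simp only [dBar, fderiv_fun_add hf hg, add_apply]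
  ring

lemma dHol_mul {f g : E → ℂ} {z : E} (hf : DifferentiableAt ℝ f z) (hg : DifferentiableAt ℝ g z)
    (v : E) : dHol v (fun z => f z * g z) z = f z * dHol v g z + dHol v f z * g z := by
  simp only [dHol, fderiv_fun_mul hf hg, add_apply,
    smul_apply, smul_eq_mul]
  ring

lemma dBar_mul {f g : E → ℂ} {z : E} (hf : DifferentiableAt ℝ f z) (hg : DifferentiableAt ℝ g z)
    (v : E) : dBar v (fun z => f z * g z) z = f z * dBar v g z + dBar v f z * g z := by
  simp only [dBar, fderiv_fun_mul hf hg, add_apply,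
    smul_apply, smul_eq_mul]
  ring

lemma dBar_const_mul {f : E → ℂ} {z : E} (hf : DifferentiableAt ℝ f z) (c : ℂ)
    (v : E) : dBar v (fun z => c * f z) z = c * dBar v f z := by
  rw [dBar_mul (differentiableAt_const c) hf, dBar_const, zero_mul, add_zero]

lemma fderiv_conj_apply (f : E → ℂ) (z v : E) :
    fderiv ℝ (fun z => conj (f z)) z v = conj (fderiv ℝ f z v) := by
  have := Complex.conjCLE.comp_fderiv (f := f) (x := z)
  have h2 : (fun z => conj (f z)) = Complex.conjCLE ∘ f := rfl
  rw [h2, this]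
  rfl

lemma dBar_conj (f : E → ℂ) (z v : E) :
    dBar v (fun z => conj (f z)) z = conj (dHol v f z) := by
  simp only [dBar, dHol, fderiv_conj_apply, map_mul, map_sub, map_div₀, map_one, map_ofNat,
    Complex.conj_I]
  ring

lemma dHol_conj (f : E → ℂ) (z v : E) :
    dHol v (fun z => conj (f z)) z = conj (dBar v f z) := by
  simp only [dBar, dHol, fderiv_conj_apply, map_mul, map_add, map_div₀, map_one, map_ofNat,
    Complex.conj_I]
  ring

lemma dBar_eq_zero {f : E → ℂ} {z : E} (hf : DifferentiableAt ℂ f z) (v : E) :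
    dBar v f z = 0 := by
  have h := (hf.hasFDerivAt.restrictScalars ℝ).fderiv
  simp only [dBar, h, ContinuousLinearMap.coe_restrictScalars', map_smul, smul_eq_mul]
  linear_combination (1 / 2 : ℂ) * fderiv ℂ f z v * Complex.I_mul_I

/-- The Cauchy–Riemann equations make the real derivative commute with `I`, hence complex linear. -/
lemma differentiableAt_of_dBar_eq_zero {f : E → ℂ} {z : E} (hf : DifferentiableAt ℝ f z)
    (h : ∀ v, dBar v f z = 0) : DifferentiableAt ℂ f z := by
  have hI : ∀ v, fderiv ℝ f z (Complex.I • v) = Complex.I * fderiv ℝ f z v := fun v => by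
    have := h v
    simp only [dBar] at this
    linear_combination (-2 * Complex.I) * this + fderiv ℝ f z (Complex.I • v) * Complex.I_mul_I
  let L : E →L[ℂ] ℂ :=
    { toFun := fderiv ℝ f z
      map_add' := map_add _
      map_smul' := fun c v => by
        have hc : c • v = c.re • v + c.im • (Complex.I • v) := by
          conv_lhs => rw [← Complex.re_add_im c]
          rw [add_smul, mul_smul, Complex.coe_smul, Complex.coe_smul]
        rw [hc, map_add, map_smul, map_smul, hI, RingHom.id_apply, smul_eq_mul,
          Complex.real_smul, Complex.real_smul]
        conv_rhs => rw [← Complex.re_add_im c]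
        ring
      cont := (fderiv ℝ f z).cont }
  have hL : L.restrictScalars ℝ = fderiv ℝ f z := rfl
  exact ((hasFDerivAt_iff_isLittleO.mpr
    (hasFDerivAt_iff_isLittleO.mp hf.hasFDerivAt :)) : HasFDerivAt f L z).differentiableAt

lemma dBar_comp {f : E' → ℂ} {g : E → E'} {z : E} {A : E →L[ℂ] E'} (hg : HasFDerivAt g A z)
    (hf : DifferentiableAt ℝ f (g z)) (v : E) :
    dBar v (fun z => f (g z)) z = dBar (A v) f (g z) := by
  have h : HasFDerivAt (fun z => f (g z)) ((fderiv ℝ f (g z)).comp (A.restrictScalars ℝ)) z :=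
    hf.hasFDerivAt.comp z (hg.restrictScalars ℝ)
  simp [dBar, h.fderiv]

lemma dHol_comp {f : E' → ℂ} {g : E → E'} {z : E} {A : E →L[ℂ] E'} (hg : HasFDerivAt g A z)
    (hf : DifferentiableAt ℝ f (g z)) (v : E) :
    dHol v (fun z => f (g z)) z = dHol (A v) f (g z) := by
  have h : HasFDerivAt (fun z => f (g z)) ((fderiv ℝ f (g z)).comp (A.restrictScalars ℝ)) z :=
    hf.hasFDerivAt.comp z (hg.restrictScalars ℝ)
  simp [dHol, h.fderiv]

lemma differentiableAt_dBar {f : E → ℂ} {z : E} (hf : ContDiffAt ℝ 2 f z) (v : E) :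
    DifferentiableAt ℝ (dBar v f) z := by
  have h1 : DifferentiableAt ℝ (fderiv ℝ f) z :=
    (hf.fderiv_right (m := 1) (by norm_num)).differentiableAt (by simp)
  unfold dBar
  fun_prop

/-- The cross terms in `v` and `I • v` cancel by symmetry of the second derivative. -/
lemma dHol_dBar_eq {f : E → ℂ} {z : E} (hf : ContDiffAt ℝ 2 f z) (v : E) :
    dHol v (dBar v f) z = (1 / 4 : ℂ) * (fderiv ℝ (fderiv ℝ f) z v v
      + fderiv ℝ (fderiv ℝ f) z (Complex.I • v) (Complex.I • v)) := by
  have h1 : DifferentiableAt ℝ (fderiv ℝ f) z :=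
    (hf.fderiv_right (m := 1) (by norm_num)).differentiableAt (by simp)
  have h2 : ∀ v w : E, fderiv ℝ (dBar v f) z w = (1 / 2 : ℂ) * (fderiv ℝ (fderiv ℝ f) z w v
      + Complex.I * fderiv ℝ (fderiv ℝ f) z w (Complex.I • v)) := fun v w => by
    have ha : ∀ u : E, HasFDerivAt (fun z => fderiv ℝ f z u)
        ((fderiv ℝ (fderiv ℝ f) z).flip u) z := fun u => by
      have := h1.hasFDerivAt.clm_apply (hasFDerivAt_const u z)
      simpa using this
    have := (((ha v).add ((ha (Complex.I • v)).const_mul Complex.I)).const_mul (1 / 2 : ℂ))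
    have h3 : fderiv ℝ (dBar v f) z = _ := this.fderiv
    rw [h3]
    simp [mul_add]
  have hsymm := (hf.isSymmSndFDerivAt (by simp)).eq v (Complex.I • v)
  simp only [dHol, h2]
  rw [hsymm]
  linear_combination (-1 / 4 : ℂ) * fderiv ℝ (fderiv ℝ f) z (Complex.I • v) (Complex.I • v)
    * Complex.I_mul_I

/-- This reduces plurisubharmonicity to subharmonicity on complex lines, where the one-variable
maximum principle applies. -/
lemma laplacian_re_comp_line {f : E → ℂ} {z₀ v : E} {t : ℂ} (hf : ContDiffAt ℝ 2 f (z₀ + t • v)) :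
    Δ (fun t : ℂ => (f (z₀ + t • v)).re) t = 4 * (dHol v (dBar v f) (z₀ + t • v)).re := by
  have hline : ∀ t : ℂ, HasFDerivAt (fun t : ℂ => z₀ + t • v)
      (((1 : ℂ →L[ℂ] ℂ).smulRight v).restrictScalars ℝ) t := fun t =>
    (((hasFDerivAt_id t).smul_const v).const_add z₀).restrictScalars ℝ
  set A : ℂ →L[ℝ] E := ((1 : ℂ →L[ℂ] ℂ).smulRight v).restrictScalars ℝ with hA
  have hd1 : fderiv ℝ (fun t : ℂ => (f (z₀ + t • v)).re) =ᶠ[𝓝 t]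
      fun t => Complex.reCLM.comp ((fderiv ℝ f (z₀ + t • v)).comp A) := by
    filter_upwards [(hline t).continuousAt.tendsto.eventually (hf.eventually (by simp))] with t ht
    have := (ht.differentiableAt (by simp)).hasFDerivAt.comp t (hline t)
    exact (Complex.reCLM.hasFDerivAt.comp t this).fderiv
  have h1 : DifferentiableAt ℝ (fderiv ℝ f) (z₀ + t • v) :=
    (hf.fderiv_right (m := 1) (by norm_num)).differentiableAt (by simp)
  have hd2 : ∀ m, fderiv ℝ (fderiv ℝ (fun t : ℂ => (f (z₀ + t • v)).re)) t m m =
      (fderiv ℝ (fderiv ℝ f) (z₀ + t • v) (m • v) (m • v)).re := fun m => by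
    rw [hd1.fderiv_eq]
    have h2 : HasFDerivAt (fun t : ℂ => fderiv ℝ f (z₀ + t • v))
        ((fderiv ℝ (fderiv ℝ f) (z₀ + t • v)).comp A) t := h1.hasFDerivAt.comp t (hline t)
    have h3 := (hasFDerivAt_const Complex.reCLM t).clm_comp
      (h2.clm_comp (hasFDerivAt_const A t))
    rw [h3.fderiv]
    simp [hA]
  rw [laplacian_eq_iteratedFDeriv_complexPlane]
  simp only [iteratedFDeriv_two_apply]
  simp only [Matrix.cons_val_zero, Matrix.cons_val_one, hd2, one_smul, dHol_dBar_eq hf]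
  simp [Complex.mul_re]

end Wirtinger

/-- A smooth function on a compact connected complex manifold that is plurisubharmonic in the
charts is constant. -/
theorem exists_re_eq_const_of_plurisubharmonic {E : Type*} [NormedAddCommGroup E] [NormedSpace ℂ E]
    {M : Type*} [TopologicalSpace M] [CompactSpace M] [ConnectedSpace M] [ChartedSpace E M]
    {f : M → ℂ}
    (hf : ∀ p, ContDiffOn ℝ 2 (fun z => f ((extChartAt 𝓘(ℂ, E) p).symm z))
      (extChartAt 𝓘(ℂ, E) p).target)
    (hpsh : ∀ p, ∀ z ∈ (extChartAt 𝓘(ℂ, E) p).target, ∀ v,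
      0 ≤ (dHol v (dBar v (fun z => f ((extChartAt 𝓘(ℂ, E) p).symm z))) z).re) :
    ∃ c, ∀ y, (f y).re = c := by
  have hcont : Continuous f := continuous_iff_continuousAt.mpr fun p => by
    have h1 : ContinuousAt (fun z => f ((extChartAt 𝓘(ℂ, E) p).symm z))
        (extChartAt 𝓘(ℂ, E) p p) :=
      ((hf p).continuousOn).continuousAt (extChartAt_target_mem_nhds p)
    have h2 := ContinuousAt.comp (f := extChartAt 𝓘(ℂ, E) p) h1 (continuousAt_extChartAt p)
    refine h2.congr ?_
    filter_upwards [extChartAt_source_mem_nhds (I := 𝓘(ℂ, E)) p] with y hy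
    simp only [Function.comp, (extChartAt 𝓘(ℂ, E) p).left_inv hy]
  have hre : Continuous fun y => (f y).re := Complex.continuous_re.comp hcont
  obtain ⟨y₀, -, hmax⟩ := isCompact_univ.exists_isMaxOn (univ_nonempty (α := M))
    hre.continuousOn
  refine ⟨(f y₀).re, fun y => ?_⟩
  have hclosed : IsClosed {y | (f y).re = (f y₀).re} := isClosed_eq hre continuous_const
  -- The set where the maximum is attained is clopen; openness is the strong maximum principle on
  -- complex lines through `p` in a chart.
  have hopen : IsOpen {y | (f y).re = (f y₀).re} := by
    rw [isOpen_iff_mem_nhds]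
    intro p hp
    have hp : (f p).re = (f y₀).re := hp
    set φ := extChartAt 𝓘(ℂ, E) p with hφ
    have htopen : IsOpen φ.target := isOpen_extChartAt_target p
    obtain ⟨R, hR, hball⟩ := Metric.isOpen_iff.mp htopen (φ p) (mem_extChartAt_target p)
    have hconst : ∀ z ∈ ball (φ p) R, (f (φ.symm z)).re = (f y₀).re := by
      intro z hz
      have hsymm : φ.symm (φ p) = p := extChartAt_to_inv p
      by_cases hv : z - φ p = 0
      · rw [sub_eq_zero.mp hv, hsymm, hp]
      set v := z - φ p with hvdef
      have hvpos : 0 < ‖v‖ := norm_pos_iff.mpr hv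
      have hmem : ∀ t ∈ ball (0 : ℂ) (R / ‖v‖), φ p + t • v ∈ φ.target := fun t ht => by
        apply hball
        rw [mem_ball_zero_iff, lt_div_iff₀ hvpos] at ht
        rw [mem_ball, dist_eq_norm, add_sub_cancel_left, norm_smul]
        exact ht
      have hF : ∀ t ∈ ball (0 : ℂ) (R / ‖v‖),
          ContDiffAt ℝ 2 (fun z => f (φ.symm z)) (φ p + t • v) := fun t ht =>
        (hf p).contDiffAt (htopen.mem_nhds (hmem t ht))
      -- The line is parametrized so that `t = 0` is `p` and `t = 1` is `z`; the radius `R / ‖v‖`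
      -- exceeds `1` since `z` lies in the ball.
      have h := eqOn_of_laplacian_nonneg (g := fun t : ℂ => (f (φ.symm (φ p + t • v))).re)
        (R := R / ‖v‖)
        (fun t ht => by
          have h1 : ContDiffAt ℝ 2 (fun t : ℂ => φ p + t • v) t := by fun_prop
          exact (Complex.reCLM.contDiff.contDiffAt.comp t
            ((hF t ht).comp t h1)).contDiffWithinAt)
        (fun t ht => by
          have h1 := laplacian_re_comp_line (hF t ht)
          have h2 := hpsh p _ (hmem t ht) v
          rw [h1]
          exact mul_nonneg (by norm_num) h2)
        (fun t ht => by
          simp only [zero_smul, add_zero, hsymm, hp]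
          exact hmax (mem_univ _))
        1 (by
          rw [mem_ball_zero_iff, norm_one, one_lt_div hvpos]
          simpa [dist_eq_norm] using hz)
      simpa [hsymm, hp, hvdef] using h
    have hnhds : φ ⁻¹' ball (φ p) R ∩ φ.source ∈ 𝓝 p :=
      inter_mem ((continuousAt_extChartAt p).preimage_mem_nhds (ball_mem_nhds _ hR))
        (extChartAt_source_mem_nhds p)
    filter_upwards [hnhds] with y hy
    have := hconst _ hy.1
    rwa [φ.left_inv hy.2] at this
  exact (IsClopen.eq_univ ⟨hclosed, hopen⟩ ⟨y₀, rfl⟩).ge (mem_univ y)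

end HermitianProduct

end

/-! ### Linear form of the curvature condition -/

noncomputable section

namespace HermitianProduct

open Set Metric Filter Topology ComplexConjugate

section Sesquilinear

variable {V : Type*} [AddCommGroup V] [Module ℂ V]

/-- The dual norm of a linear form with respect to a positive definite sesquilinear form, expressed
through the inverse Gram matrix. -/
lemma exists_riesz_gram {ι : Type*} [Fintype ι] [DecidableEq ι] (b : Module.Basis ι ℂ V)
    (s : V →ₗ[ℂ] V →ₗ⋆[ℂ] ℂ) (hherm : ∀ u v, s u v = conj (s v u))
    (hpos : ∀ u, u ≠ 0 → 0 < (s u u).re) (β : V →ₗ[ℂ] ℂ) :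
    ∃ w, (∀ e, β e = s e w) ∧
      ∑ i, ∑ j, (Matrix.of fun i j => s (b i) (b j))⁻¹ j i * conj (β (b j)) * β (b i) = s w w := by
  set G : Matrix ι ι ℂ := Matrix.of fun i j => s (b i) (b j) with hG
  have hmul : ∀ (x : ι → ℂ) (v : V), s v (∑ j, conj (x j) • b j) = ∑ j, x j * s v (b j) :=
    fun x v => by simp [map_sum]
  -- If `G x = 0`, the vector with coordinates `conj x` is orthogonal to the whole basis, hence to
  -- itself, and vanishes by positivity.
  have hinj : Function.Injective G.mulVec := by
    rw [← Matrix.coe_mulVecLin, injective_iff_map_eq_zero]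
    intro x hx
    have h1 : ∀ i, s (b i) (∑ j, conj (x j) • b j) = 0 := fun i => by
      rw [hmul]
      simpa [Matrix.mulVec, dotProduct, hG, mul_comm] using congrFun hx i
    have h2 : s (∑ j, conj (x j) • b j) (∑ j, conj (x j) • b j) = 0 := by
      have h0 : s.flip (∑ j, conj (x j) • b j) = 0 := b.ext h1
      exact congrArg (fun l : V →ₗ[ℂ] ℂ => l (∑ j, conj (x j) • b j)) h0
    have h3 : ∑ j, conj (x j) • b j = 0 := by
      by_contra hne
      have := hpos _ hne
      rw [h2] at this
      exact lt_irrefl _ this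
    have h4 := (Fintype.linearIndependent_iff.mp b.linearIndependent) _ h3
    ext i
    simpa using h4 i
  have hunit : IsUnit G := Matrix.mulVec_injective_iff_isUnit.mp hinj
  have hGG : G * G⁻¹ = 1 := Matrix.mul_nonsing_inv _ ((Matrix.isUnit_iff_isUnit_det _).mp hunit)
  -- The form is conjugate linear in its second slot, so the Riesz vector `w` has coordinates `conj
  -- x` for the solution `x` of `G x = β`.
  set x : ι → ℂ := G⁻¹.mulVec fun i => β (b i) with hx
  have hGx : ∀ i, ∑ j, x j * s (b i) (b j) = β (b i) := fun i => by
    have : G.mulVec x = fun i => β (b i) := by rw [hx, Matrix.mulVec_mulVec, hGG, Matrix.one_mulVec]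
    have := congrFun this i
    simpa [Matrix.mulVec, dotProduct, hG, mul_comm] using this
  set w : V := ∑ j, conj (x j) • b j with hw
  have hβ : ∀ e, β e = s e w := fun e => by
    have : β = s.flip w := b.ext fun i => by
      rw [LinearMap.flip_apply, hmul, hGx]
    rw [this, LinearMap.flip_apply]
  refine ⟨w, hβ, ?_⟩
  rw [Finset.sum_comm]
  calc ∑ j, ∑ i, G⁻¹ j i * conj (β (b j)) * β (b i) = ∑ j, x j * conj (β (b j)) := by
        refine Finset.sum_congr rfl fun j _ => ?_
        rw [hx, Matrix.mulVec, dotProduct, Finset.sum_mul]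
        exact Finset.sum_congr rfl fun i _ => by ring
    _ = ∑ j, x j * s w (b j) := by
        refine Finset.sum_congr rfl fun j _ => ?_
        rw [hβ, ← hherm]
    _ = s w w := (hmul x w).symm

/-- A positive definite form dominates the linear forms through their dual norms. -/
lemma two_re_sub_le {s : V →ₗ[ℂ] V →ₗ⋆[ℂ] ℂ} (hherm : ∀ u v, s u v = conj (s v u))
    (hnonneg : ∀ u, 0 ≤ (s u u).re) (e w : V) :
    2 * (s e w).re - (s e e).re ≤ (s w w).re := by
  have h := hnonneg (e - w)
  simp only [map_sub, LinearMap.sub_apply, Complex.sub_re] at h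
  rw [hherm w e, Complex.conj_re] at h
  linarith

end Sesquilinear

variable {E H : Type*} [NormedAddCommGroup E] [NormedSpace ℂ E] [TopologicalSpace H]
  {I : ModelWithCorners ℂ E H} {M : Type*} [TopologicalSpace M] [ChartedSpace H M]

/-- The form `comp h p · · z` on the model space. -/
def compForm (h : SesqField I M) (p : M) (z : E) : E →ₗ[ℂ] E →ₗ⋆[ℂ] ℂ :=
  LinearMap.mk₂'ₛₗ (RingHom.id ℂ) (starRingEnd ℂ) (fun u v => comp h p u v z)
    (fun u u' v => by simp only [comp, map_add, LinearMap.add_apply])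
    (fun c u v => by simp only [comp, map_smul, LinearMap.smul_apply]; rfl)
    (fun u v v' => by simp only [comp, map_add])
    (fun c u v => by simp only [comp, map_smul, LinearMap.map_smulₛₗ])

lemma compForm_apply (h : SesqField I M) (p : M) (z u v : E) :
    compForm h p z u v = comp h p u v z := rfl

lemma comp_add (h h' : SesqField I M) (p : M) (u v : E) :
    comp (h + h') p u v = fun z => comp h p u v z + comp h' p u v z := rfl

lemma comp_add_left (h : SesqField I M) (p : M) (u u' v : E) :
    comp h p (u + u') v = fun z => comp h p u v z + comp h p u' v z :=
  funext fun z => congrArg (fun l => l v) (map_add (compForm h p z) u u')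

lemma comp_smul_left (h : SesqField I M) (p : M) (c : ℂ) (u v : E) :
    comp h p (c • u) v = fun z => c * comp h p u v z :=
  funext fun z => congrArg (fun l => l v) (map_smul (compForm h p z) c u)

lemma IsHermitianMetric.comp_conj {h : SesqField I M} (hh : IsHermitianMetric h) (p : M)
    (u v : E) (z : E) : comp h p u v z = conj (comp h p v u z) :=
  hh.hermitian _ _ _

section Boundaryless

variable [I.Boundaryless]

lemma coordVec_isInvertible [IsManifold I 1 M] {p : M} {z : E}
    (hz : z ∈ (extChartAt I p).target) : (coordVec I p z).IsInvertible := by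
  have := isInvertible_mfderivWithin_extChartAt_symm hz
  rwa [I.range_eq_univ, mfderivWithin_univ] at this

lemma coordVec_surjective [IsManifold I 1 M] {p : M} {z : E}
    (hz : z ∈ (extChartAt I p).target) : Function.Surjective (coordVec I p z) :=
  (coordVec_isInvertible hz).bijective.2

lemma coordVec_injective [IsManifold I 1 M] {p : M} {z : E}
    (hz : z ∈ (extChartAt I p).target) : Function.Injective (coordVec I p z) :=
  (coordVec_isInvertible hz).bijective.1

lemma IsHermitianMetric.comp_pos [IsManifold I 1 M] {h : SesqField I M} (hh : IsHermitianMetric h)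
    {p : M} {z : E} (hz : z ∈ (extChartAt I p).target) {u : E} (hu : u ≠ 0) :
    0 < (comp h p u u z).re :=
  hh.pos _ _ fun h0 => hu (coordVec_injective hz (h0.trans (map_zero _).symm))

lemma IsHermitianMetric.contDiffAt {h : SesqField I M} (hh : IsHermitianMetric h) {p : M} {z : E}
    (hz : z ∈ (extChartAt I p).target) (u v : E) : ContDiffAt ℝ ∞ (comp h p u v) z :=
  (hh.smooth p u v).contDiffAt ((isOpen_extChartAt_target p).mem_nhds hz)

lemma IsHermitianMetric.differentiableAt {h : SesqField I M} (hh : IsHermitianMetric h) {p : M}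
    {z : E} (hz : z ∈ (extChartAt I p).target) (u v : E) : DifferentiableAt ℝ (comp h p u v) z :=
  (hh.contDiffAt hz u v).differentiableAt (by simp)

lemma IsHermitianMetric.contDiffAt_two {h : SesqField I M} (hh : IsHermitianMetric h) {p : M}
    {z : E} (hz : z ∈ (extChartAt I p).target) (u v : E) : ContDiffAt ℝ 2 (comp h p u v) z :=
  contDiffAt_infty.mp (hh.contDiffAt hz u v) 2

/-- The linear form `e ↦ ∂_v̄ h(e, u)`. -/
def IsHermitianMetric.dBarForm {h : SesqField I M} (hh : IsHermitianMetric h) {p : M}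
    {z : E} (hz : z ∈ (extChartAt I p).target) (u v : E) : E →ₗ[ℂ] ℂ where
  toFun e := dBar v (comp h p e u) z
  map_add' e e' := by
    rw [comp_add_left, dBar_add (hh.differentiableAt hz _ _) (hh.differentiableAt hz _ _)]
  map_smul' c e := by
    rw [comp_smul_left, dBar_const_mul (hh.differentiableAt hz _ _)]
    rfl

/-- The inequality `2 Re ∂_v̄ h(e, u) - h(e, e) ≤ ∂_v ∂_v̄ h(u, u)`, linear in `h`, which for Hermitian
metrics is equivalent to nonpositivity of the bisectional curvature. -/
def CurvatureInequality (h : SesqField I M) : Prop :=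
  ∀ (p : M), ∀ z ∈ (extChartAt I p).target, ∀ u v e : E,
    2 * (dBar v (comp h p e u) z).re - (comp h p e e z).re ≤
      (dHol v (dBar v (comp h p u u)) z).re

/-- The quadratic term of the curvature is the squared dual norm of `β = ∂_v̄ h(·, u)`, that is
`h(w, w)` for its Riesz vector `w`. Expanding `h(e - w, e - w) ≥ 0` shows that it bounds every `2 Re
β(e) - h(e, e)`, with equality at `e = w`. -/
theorem nonposBisectional_iff [FiniteDimensional ℂ E] [IsManifold I 1 M] {h : SesqField I M}
    (hh : IsHermitianMetric h) : NonposBisectional h ↔ CurvatureInequality h := by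
  refine forall_congr' fun p => forall₂_congr fun z hz => forall₂_congr fun u v => ?_
  have hherm : ∀ u v, compForm h p z u v = conj (compForm h p z v u) :=
    fun u v => hh.comp_conj p u v z
  have hpos : ∀ u, u ≠ 0 → 0 < (compForm h p z u u).re := fun u hu => hh.comp_pos hz hu
  obtain ⟨w, hw, hQ⟩ := exists_riesz_gram (Module.finBasis ℂ E) (compForm h p z) hherm hpos
    (hh.dBarForm hz u v)
  have hw' : ∀ e, dBar v (comp h p e u) z = compForm h p z e w := hw
  have hQ' : ∑ i, ∑ j, (gram h p z)⁻¹ j i * dHol v (comp h p u (Module.finBasis ℂ E j)) z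
      * dBar v (comp h p (Module.finBasis ℂ E i) u) z = compForm h p z w w := by
    rw [← hQ]
    refine Finset.sum_congr rfl fun i _ => Finset.sum_congr rfl fun j _ => ?_
    -- Hermitian symmetry turns the `∂_v` factor of the curvature into the conjugate of `β`.
    have h1 : dHol v (comp h p u (Module.finBasis ℂ E j)) z
        = conj (hh.dBarForm hz u v (Module.finBasis ℂ E j)) := by
      have : comp h p u (Module.finBasis ℂ E j)
          = fun z => conj (comp h p (Module.finBasis ℂ E j) u z) :=
        funext fun z => hh.comp_conj p _ _ z
      rw [this, dHol_conj]
      rfl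
    rw [h1]
    rfl
  rw [chernCurvature, hQ', Complex.add_re, Complex.neg_re]
  constructor
  · intro hle e
    have hnonneg : ∀ u, 0 ≤ (compForm h p z u u).re := fun u => by
      by_cases hu : u = 0
      · simp [hu]
      · exact (hpos u hu).le
    have := two_re_sub_le hherm hnonneg e w
    rw [hw' e]
    rw [compForm_apply h p z e e] at this
    linarith
  · intro hle
    have := hle w
    rw [hw' w, ← compForm_apply] at this
    linarith

lemma mem_nonposMetrics_iff [FiniteDimensional ℂ E] [IsManifold I 1 M] {h : SesqField I M} :
    h ∈ nonposMetrics I M ↔ IsHermitianMetric h ∧ CurvatureInequality h :=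
  and_congr_right fun hh => nonposBisectional_iff hh

end Boundaryless

end HermitianProduct

end

/-! ### Smoothness of holomorphic functions of several variables -/

noncomputable section

namespace HermitianProduct

open Set Metric Filter Topology ComplexConjugate MeasureTheory

section Osgood

variable {E : Type*} [NormedAddCommGroup E] [NormedSpace ℂ E]

/-- By continuity `f` varies by less than `2` on a ball of radius `3 * R`; the Cauchy estimate on
balls of radius `R` then bounds the derivative by `2 / R` on the ball of radius `2 * R`. -/
lemma exists_lipschitzOnWith_of_differentiableOn {f : E → ℂ} {s : Set E} (hs : IsOpen s)
    (hf : DifferentiableOn ℂ f s) {z₀ : E} (hz₀ : z₀ ∈ s) :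
    ∃ R > 0, ball z₀ (2 * R) ⊆ s ∧ ∃ K, LipschitzOnWith K f (ball z₀ (2 * R)) := by
  have hnear : ∀ᶠ z in 𝓝 z₀, z ∈ s ∧ dist (f z) (f z₀) < 1 :=
    (hs.eventually_mem hz₀).and
      ((hf.continuousOn.continuousAt (hs.mem_nhds hz₀)).eventually (ball_mem_nhds _ one_pos))
  obtain ⟨R', hR', hball⟩ := Metric.eventually_nhds_iff.mp hnear
  set R := R' / 3 with hRdef
  have hR : 0 < R := by positivity
  have hsub : ball z₀ (2 * R) ⊆ ball z₀ R' := ball_subset_ball (by rw [hRdef]; linarith)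
  have hss : ball z₀ R' ⊆ s := fun z hz => (hball hz).1
  refine ⟨R, hR, hsub.trans hss, (2 / R).toNNReal, ?_⟩
  refine Convex.lipschitzOnWith_of_nnnorm_fderiv_le (𝕜 := ℂ)
    (fun z hz => (hf.differentiableAt (hs.mem_nhds (hss (hsub hz))))) (fun z hz => ?_)
    (convex_ball _ _)
  rw [← NNReal.coe_le_coe, coe_nnnorm, Real.coe_toNNReal _ (by positivity)]
  have hsub' : ball z R ⊆ ball z₀ R' := ball_subset_ball' (by
    rw [mem_ball] at hz; linarith)
  refine Complex.norm_fderiv_le_div_of_mapsTo_ball (hf.mono (hsub'.trans hss)) (fun y hy => ?_) hR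
  have h1 := (hball (hsub' hy)).2
  have h2 := (hball (hsub hz)).2
  rw [mem_closedBall]
  linarith [dist_triangle_right (f y) (f z) (f z₀)]

lemma hasDerivAt_comp_line {f : E → ℂ} {z v : E} {t : ℂ}
    (hf : DifferentiableAt ℂ f (z + t • v)) :
    HasDerivAt (fun t : ℂ => f (z + t • v)) (fderiv ℂ f (z + t • v) v) t := by
  have hline : HasDerivAt (fun t : ℂ => z + t • v) v t := by
    simpa using ((hasDerivAt_id t).smul_const v).const_add z
  exact hf.hasFDerivAt.comp_hasDerivAt t hline

/-- The derivatives of a holomorphic function of several variables are holomorphic. -/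
lemma differentiableOn_fderiv_apply [FiniteDimensional ℂ E] {f : E → ℂ} {s : Set E}
    (hs : IsOpen s) (hf : DifferentiableOn ℂ f s) (v : E) :
    DifferentiableOn ℂ (fun z => fderiv ℂ f z v) s := by
  intro z₀ hz₀
  obtain ⟨R, hR, hRs, K, hK⟩ := exists_lipschitzOnWith_of_differentiableOn hs hf hz₀
  have hfat : ∀ z ∈ ball z₀ (2 * R), DifferentiableAt ℂ f z := fun z hz =>
    hf.differentiableAt (hs.mem_nhds (hRs hz))
  -- Small enough that circles of radius `r` in direction `v` around points of `ball z₀ R` stay in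
  -- `ball z₀ (2 * R)`, and nonzero even for `v = 0`.
  set r := R / (‖v‖ + 1) with hrdef
  have hr : 0 < r := by positivity
  have hrv : r * ‖v‖ < R := by
    rw [hrdef, div_mul_eq_mul_div, div_lt_iff₀ (by positivity)]
    nlinarith [norm_nonneg v]
  have hmem : ∀ z ∈ ball z₀ R, ∀ t ∈ closedBall (0 : ℂ) r, z + t • v ∈ ball z₀ (2 * R) := by
    intro z hz t ht
    rw [mem_ball, dist_eq_norm] at hz ⊢
    rw [mem_closedBall_zero_iff] at ht
    calc ‖z + t • v - z₀‖ = ‖(z - z₀) + t • v‖ := by congr 1; abel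
      _ ≤ ‖z - z₀‖ + ‖t‖ * ‖v‖ := by rw [← norm_smul]; exact norm_add_le _ _
      _ < R + R := add_lt_add hz (lt_of_le_of_lt (by gcongr) hrv)
      _ = 2 * R := by ring
  have hcm : ∀ θ, circleMap 0 r θ ∈ closedBall (0 : ℂ) r := fun θ =>
    circleMap_mem_closedBall 0 hr.le θ
  set c : ℝ → ℂ := fun θ => deriv (circleMap 0 r) θ * (1 / (circleMap 0 r θ - 0) ^ 2) with hc
  have hcne : ∀ θ, circleMap 0 r θ - 0 ≠ 0 := fun θ => by
    simpa using circleMap_ne_center (c := 0) hr.ne' (θ := θ)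
  have hccont : Continuous c := by
    simp only [hc, deriv_circleMap]
    have : Continuous (circleMap 0 r) := continuous_circleMap 0 r
    refine (this.mul continuous_const).mul (continuous_const.div₀ ((this.sub continuous_const).pow 2) ?_)
    exact fun θ => pow_ne_zero 2 (hcne θ)
  have hcauchy : ∀ z ∈ ball z₀ R, ∫ θ in (0)..2 * Real.pi, c θ * f (z + circleMap 0 r θ • v)
      = (2 * Real.pi * Complex.I) * fderiv ℂ f z v := by
    intro z hz
    have hd : DifferentiableOn ℂ (fun t : ℂ => f (z + t • v)) (closedBall 0 r) := fun t ht =>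
      (hasDerivAt_comp_line (hfat _ (hmem z hz t ht))).differentiableAt.differentiableWithinAt
    have h1 := hd.deriv_eq_smul_circleIntegral hr
    have h2 : deriv (fun t : ℂ => f (z + t • v)) 0 = fderiv ℂ f z v := by
      have := (hasDerivAt_comp_line (hfat _ (hmem z hz 0 (by simp [hr.le])))).deriv
      simpa using this
    rw [h2, smul_eq_mul] at h1
    rw [← h1]
    simp only [circleIntegral, hc, smul_eq_mul, mul_assoc]
  have hcomp : ∀ z ∈ ball z₀ R, Continuous fun θ => c θ * f (z + circleMap 0 r θ • v) := by
    intro z hz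
    refine hccont.mul (continuous_iff_continuousAt.mpr fun θ => ?_)
    have h1 : ContinuousAt f (z + circleMap 0 r θ • v) :=
      (hfat _ (hmem z hz _ (hcm θ))).continuousAt
    have h2 : ContinuousAt (fun θ => z + circleMap 0 r θ • v) θ :=
      (continuous_const.add ((continuous_circleMap 0 r).smul continuous_const)).continuousAt
    exact ContinuousAt.comp (f := fun θ => z + circleMap 0 r θ • v) h1 h2
  borelize E
  have hproper : ProperSpace E := FiniteDimensional.proper ℂ E
  have hproper' : ProperSpace (E →L[ℂ] ℂ) := FiniteDimensional.proper ℂ _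
  -- Continuity of the derivative is not yet known; measurability and the Lipschitz bound suffice to
  -- differentiate Cauchy's formula under the integral.
  have hmeas : Measurable fun θ => c θ • fderiv ℂ f (z₀ + circleMap 0 r θ • v) := by
    refine hccont.measurable.smul ((measurable_fderiv ℂ f).comp ?_)
    exact (continuous_const.add ((continuous_circleMap 0 r).smul continuous_const)).measurable
  have hderiv := (intervalIntegral.hasFDerivAt_integral_of_dominated_loc_of_lip (𝕜 := ℂ)
    (μ := volume) (a := 0) (b := 2 * Real.pi) (x₀ := z₀) (s := ball z₀ R)
    (F := fun z θ => c θ * f (z + circleMap 0 r θ • v))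
    (F' := fun θ => c θ • fderiv ℂ f (z₀ + circleMap 0 r θ • v))
    (bound := fun θ => ‖c θ‖ * K)
    (ball_mem_nhds z₀ hR)
    (by filter_upwards [ball_mem_nhds z₀ hR] with z hz using (hcomp z hz).aestronglyMeasurable)
    ((hcomp z₀ (mem_ball_self hR)).intervalIntegrable _ _)
    hmeas.aestronglyMeasurable
    (ae_of_all _ fun θ _ => LipschitzOnWith.of_dist_le_mul fun z hz z' hz' => by
      have := hK.dist_le_mul _ (hmem z hz _ (hcm θ)) _ (hmem z' hz' _ (hcm θ))
      rw [dist_add_right] at this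
      rw [dist_eq_norm, ← mul_sub, norm_mul, ← dist_eq_norm, Real.coe_nnabs,
        abs_of_nonneg (by positivity), mul_assoc]
      gcongr)
    ((hccont.norm.mul continuous_const).intervalIntegrable _ _)
    (ae_of_all _ fun θ _ => by
      have h1 := (hfat _ (hmem z₀ (mem_ball_self hR) _ (hcm θ))).hasFDerivAt
      have h2 : HasFDerivAt (fun z => z + circleMap 0 r θ • v) (ContinuousLinearMap.id ℂ E) z₀ :=
        (hasFDerivAt_id z₀).add_const _
      exact (h1.comp z₀ h2).const_mul (c θ))).2
  have hne : (2 * Real.pi * Complex.I : ℂ) ≠ 0 := Complex.two_pi_I_ne_zero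
  have hfin := hderiv.differentiableAt.const_mul (2 * Real.pi * Complex.I : ℂ)⁻¹
  refine (hfin.congr_of_eventuallyEq ?_).differentiableWithinAt
  filter_upwards [ball_mem_nhds z₀ hR] with z hz
  rw [hcauchy z hz, inv_mul_cancel_left₀ hne]

lemma contDiffOn_of_differentiableOn [FiniteDimensional ℂ E] {f : E → ℂ} {s : Set E}
    (hs : IsOpen s) (hf : DifferentiableOn ℂ f s) : ContDiffOn ℝ ∞ f s := by
  have key : ∀ n : ℕ, ∀ f : E → ℂ, DifferentiableOn ℂ f s → ContDiffOn ℂ n f s := by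
    intro n
    induction n with
    | zero => exact fun f hf => contDiffOn_zero.mpr hf.continuousOn
    | succ n ih =>
      intro f hf
      rw [Nat.cast_succ, contDiffOn_succ_iff_fderiv_of_isOpen hs]
      refine ⟨hf, by simp, contDiffOn_clm_apply.mpr fun v => ?_⟩
      exact ih _ (differentiableOn_fderiv_apply hs hf v)
  exact contDiffOn_infty.mpr fun n => (key n f hf).restrict_scalars ℝ

end Osgood

end HermitianProduct

end

/-! ### Holomorphic one-forms: rank-one fields and finite dimensionality -/

noncomputable section

namespace HermitianProduct

open Set Metric Filter Topology ComplexConjugate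

section OneForms

variable {E H : Type*} [NormedAddCommGroup E] [NormedSpace ℂ E] [TopologicalSpace H]
  {I : ModelWithCorners ℂ E H} {M : Type*} [TopologicalSpace M] [ChartedSpace H M]

/-- The component of a field of linear forms in the preferred chart at `p`. -/
def formComp (φ : ∀ x : M, TangentSpace I x →ₗ[ℂ] ℂ) (p : M) (u z : E) : ℂ :=
  φ ((extChartAt I p).symm z) (coordVec I p z u)

/-- The field `φ ⊗ φ̄`. -/
def rankOne (φ : ∀ x : M, TangentSpace I x →ₗ[ℂ] ℂ) : SesqField I M := fun x =>
  LinearMap.mk₂'ₛₗ (RingHom.id ℂ) (starRingEnd ℂ) (fun u v => φ x u * conj (φ x v))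
    (fun u u' v => by rw [map_add, add_mul])
    (fun c u v => by rw [map_smul, smul_eq_mul, mul_assoc]; rfl)
    (fun u v v' => by rw [map_add, map_add, mul_add])
    (fun c u v => by rw [map_smul, smul_eq_mul, map_mul, smul_eq_mul]; ring)

lemma comp_rankOne (φ : ∀ x : M, TangentSpace I x →ₗ[ℂ] ℂ) (p : M) (u v : E) :
    comp (rankOne φ) p u v = fun z => formComp φ p u z * conj (formComp φ p v z) := rfl

lemma dBar_mul_conj {f g : E → ℂ} {z : E} (hf : DifferentiableAt ℂ f z)
    (hg : DifferentiableAt ℂ g z) (v : E) :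
    dBar v (fun z => f z * conj (g z)) z = f z * conj (dHol v g z) := by
  have hg' : DifferentiableAt ℝ (fun z => conj (g z)) z :=
    Complex.conjCLE.differentiableAt.comp z (hg.restrictScalars ℝ)
  rw [dBar_mul (hf.restrictScalars ℝ) hg', dBar_eq_zero hf, zero_mul, add_zero, dBar_conj]

lemma dHol_eq_fderiv {f : E → ℂ} {z : E} (hf : DifferentiableAt ℂ f z) (v : E) :
    dHol v f z = fderiv ℂ f z v := by
  have h := (hf.hasFDerivAt.restrictScalars ℝ).fderiv
  simp only [dHol, h, ContinuousLinearMap.coe_restrictScalars', map_smul, smul_eq_mul]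
  linear_combination (-1 / 2 : ℂ) * fderiv ℂ f z v * Complex.I_mul_I

/-- The identity `∂∂̄|f|² = |∂f|²`; the terms containing `∂̄f` or `∂̄∂f` vanish, the latter because
`∂f` is again holomorphic. -/
lemma dHol_dBar_mul_conj [FiniteDimensional ℂ E] {f : E → ℂ} {s : Set E} (hs : IsOpen s)
    (hf : DifferentiableOn ℂ f s) {z : E} (hz : z ∈ s) (v : E) :
    dHol v (dBar v (fun z => f z * conj (f z))) z = dHol v f z * conj (dHol v f z) := by
  have hat : ∀ y ∈ s, DifferentiableAt ℂ f y := fun y hy => hf.differentiableAt (hs.mem_nhds hy)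
  have h1 : dBar v (fun z => f z * conj (f z)) =ᶠ[𝓝 z] fun y => f y * conj (fderiv ℂ f y v) := by
    filter_upwards [hs.mem_nhds hz] with y hy
    rw [dBar_mul_conj (hat y hy) (hat y hy), dHol_eq_fderiv (hat y hy)]
  have hd : DifferentiableAt ℂ (fun y => fderiv ℂ f y v) z :=
    (differentiableOn_fderiv_apply hs hf v).differentiableAt (hs.mem_nhds hz)
  have hd' : DifferentiableAt ℝ (fun y => conj (fderiv ℂ f y v)) z :=
    Complex.conjCLE.differentiableAt.comp z (hd.restrictScalars ℝ)
  rw [dHol_congr h1, dHol_mul ((hat z hz).restrictScalars ℝ) hd', dHol_conj, dBar_eq_zero hd,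
    map_zero, mul_zero, zero_add, dHol_eq_fderiv (hat z hz)]

/-- Smoothness of a field of sesquilinear forms. -/
def IsSmoothField (h : SesqField I M) : Prop :=
  ∀ (p : M) (u v : E), ContDiffOn ℝ ∞ (comp h p u v) (extChartAt I p).target

lemma CurvatureInequality.add [I.Boundaryless] {h h' : SesqField I M}
    (hs : IsSmoothField h) (hs' : IsSmoothField h')
    (hh : CurvatureInequality h) (hh' : CurvatureInequality h') :
    CurvatureInequality (h + h') := by
  intro p z hz u v e
  have hat : ∀ {k : SesqField I M}, IsSmoothField k → ∀ (u v : E), ∀ y ∈ (extChartAt I p).target,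
      ContDiffAt ℝ 2 (comp k p u v) y := fun hk u v y hy =>
    contDiffAt_infty.mp ((hk p u v).contDiffAt ((isOpen_extChartAt_target p).mem_nhds hy)) 2
  have hd : ∀ {k : SesqField I M}, IsSmoothField k → ∀ (u v : E), ∀ y ∈ (extChartAt I p).target,
      DifferentiableAt ℝ (comp k p u v) y := fun hk u v y hy =>
    (hat hk u v y hy).differentiableAt (by simp)
  have h1 : dBar v (comp (h + h') p u u) =ᶠ[𝓝 z]
      fun y => dBar v (comp h p u u) y + dBar v (comp h' p u u) y := by
    filter_upwards [(isOpen_extChartAt_target p).mem_nhds hz] with y hy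
    rw [comp_add, dBar_add (hd hs u u y hy) (hd hs' u u y hy)]
  rw [dHol_congr h1, dHol_add (differentiableAt_dBar (hat hs u u z hz) v)
    (differentiableAt_dBar (hat hs' u u z hz) v), comp_add, comp_add,
    dBar_add (hd hs e u z hz) (hd hs' e u z hz)]
  simp only [Complex.add_re]
  linarith [hh p z hz u v e, hh' p z hz u v e]

lemma isSmoothField_rankOne [FiniteDimensional ℂ E] [I.Boundaryless]
    {φ : ∀ x : M, TangentSpace I x →ₗ[ℂ] ℂ} (hφ : φ ∈ holomorphicOneForms I M) :
    IsSmoothField (rankOne φ) := by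
  intro p u v
  have hs : ∀ w, ContDiffOn ℝ ∞ (formComp φ p w) (extChartAt I p).target := fun w =>
    contDiffOn_of_differentiableOn (isOpen_extChartAt_target p) (hφ p w)
  rw [comp_rankOne]
  exact (hs u).mul (Complex.conjCLE.contDiff.comp_contDiffOn (hs v))

/-- With `a = φ(e)` and `b = ∂_v φ(u)`, the inequality is `2 Re (a b̄) - |a|² ≤ |b|²`, i.e. `|a -
b|² ≥ 0`. -/
lemma curvatureInequality_rankOne [FiniteDimensional ℂ E] [I.Boundaryless]
    {φ : ∀ x : M, TangentSpace I x →ₗ[ℂ] ℂ} (hφ : φ ∈ holomorphicOneForms I M) :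
    CurvatureInequality (rankOne φ) := by
  intro p z hz u v e
  have hopen := isOpen_extChartAt_target (I := I) p
  have hat : ∀ w, DifferentiableAt ℂ (formComp φ p w) z := fun w =>
    (hφ p w).differentiableAt (hopen.mem_nhds hz)
  have hdd : dHol v (dBar v (fun z => formComp φ p u z * conj (formComp φ p u z))) z = _ :=
    dHol_dBar_mul_conj hopen (hφ p u) hz v
  simp only [comp_rankOne]
  rw [dBar_mul_conj (hat e) (hat u), hdd]
  change 2 * (_ : ℂ).re - _ ≤ (dHol v (formComp φ p u) z * conj (dHol v (formComp φ p u) z)).re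
  generalize formComp φ p e z = a
  generalize dHol v (formComp φ p u) z = b
  simp only [Complex.mul_re, Complex.conj_re, Complex.conj_im]
  nlinarith [sq_nonneg (a.re - b.re), sq_nonneg (a.im - b.im)]

lemma add_rankOne_mem_nonposMetrics [FiniteDimensional ℂ E] [I.Boundaryless] [IsManifold I 1 M]
    {φ : ∀ x : M, TangentSpace I x →ₗ[ℂ] ℂ} (hφ : φ ∈ holomorphicOneForms I M)
    {h : SesqField I M} (hh : h ∈ nonposMetrics I M) : h + rankOne φ ∈ nonposMetrics I M := by
  rw [mem_nonposMetrics_iff] at hh ⊢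
  obtain ⟨hm, hc⟩ := hh
  refine ⟨⟨fun x u v => ?_, fun x u hu => ?_, fun p u v => ?_⟩,
    hc.add hm.smooth (isSmoothField_rankOne hφ) (curvatureInequality_rankOne hφ)⟩
  · change h x u v + φ x u * conj (φ x v) = conj (h x v u + φ x v * conj (φ x u))
    rw [map_add, ← hm.hermitian, map_mul, Complex.conj_conj, mul_comm]
  · change 0 < (h x u u + φ x u * conj (φ x u)).re
    have h1 := hm.pos x u hu
    rw [Complex.add_re, Complex.mul_conj, Complex.ofReal_re]
    linarith [Complex.normSq_nonneg (φ x u)]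
  · exact (hm.smooth p u v).add (isSmoothField_rankOne hφ p u v)

lemma comp_smul_smul_re (h : SesqField I M) (p : M) (z u : E) (c : ℂ) :
    (comp h p (c • u) (c • u) z).re = ‖c‖ ^ 2 * (comp h p u u z).re := by
  have h1 : comp h p (c • u) (c • u) z = c * comp h p u (c • u) z :=
    congrFun (comp_smul_left h p c u (c • u)) z
  have h2 : comp h p u (c • u) z = conj c * comp h p u u z :=
    (compForm h p z u).map_smulₛₗ c u
  rw [h1, h2, ← mul_assoc, Complex.mul_conj, Complex.re_ofReal_mul, Complex.normSq_eq_norm_sq]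

lemma norm_sq_formComp_smul (φ : ∀ x : M, TangentSpace I x →ₗ[ℂ] ℂ) (p : M) (z u : E) (c : ℂ) :
    ‖formComp φ p (c • u) z‖ ^ 2 = ‖c‖ ^ 2 * ‖formComp φ p u z‖ ^ 2 := by
  simp only [formComp, map_smul, smul_eq_mul, norm_mul, mul_pow]

/-- The coordinate frame reaches every tangent vector, so pointwise estimates proved in a chart
become estimates on the manifold. -/
lemma forall_of_target [I.Boundaryless] [IsManifold I 1 M] {p : M} {P : ∀ x : M, TangentSpace I x → Prop} {s : Set E}
    (hs : s ⊆ (extChartAt I p).target)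
    (hP : ∀ z ∈ s, ∀ u : E, P ((extChartAt I p).symm z) (coordVec I p z u)) :
    ∀ x ∈ (extChartAt I p).source ∩ extChartAt I p ⁻¹' s, ∀ u : TangentSpace I x, P x u := by
  rintro x ⟨hx, hxs⟩
  have h1 : ∀ u : TangentSpace I ((extChartAt I p).symm (extChartAt I p x)),
      P ((extChartAt I p).symm (extChartAt I p x)) u := fun u => by
    obtain ⟨w, rfl⟩ := coordVec_surjective (hs hxs) u
    exact hP _ hxs w
  rwa [(extChartAt I p).left_inv hx] at h1

section Finiteness

variable [FiniteDimensional ℂ E]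

/-- Regularity is assumed only for fixed constant vectors; expanding in a basis gives joint
continuity in the base point and the vector. -/
lemma continuousOn_comp_diag {h : SesqField I M} (hh : IsHermitianMetric h) (p : M) :
    ContinuousOn (fun q : E × E => comp h p q.2 q.2 q.1) ((extChartAt I p).target ×ˢ univ) := by
  set b := Module.finBasis ℂ E
  have hb : ∀ i, Continuous fun u : E => b.repr u i := fun i =>
    (b.coord i).continuous_of_finiteDimensional
  have heq : ∀ q : E × E, comp h p q.2 q.2 q.1 =
      ∑ i, ∑ j, b.repr q.2 i * (conj (b.repr q.2 j) * comp h p (b i) (b j) q.1) := by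
    intro q
    rw [← compForm_apply]
    conv_lhs => rw [← b.sum_repr q.2]
    simp only [map_sum, LinearMap.sum_apply, map_smul, LinearMap.smul_apply, LinearMap.map_smulₛₗ,
      smul_eq_mul, compForm_apply]
    rw [Finset.sum_comm]
    refine Finset.sum_congr rfl fun j _ => ?_
    rw [Finset.mul_sum]
    refine Finset.sum_congr rfl fun i _ => ?_
    ring
  simp only [heq]
  refine continuousOn_finsetSum _ fun i _ => continuousOn_finsetSum _ fun j _ => ?_
  refine ((hb i).comp continuous_snd).continuousOn.mul
    ((Complex.continuous_conj.comp ((hb j).comp continuous_snd)).continuousOn.mul ?_)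
  exact (hh.smooth p _ _).continuousOn.comp continuous_fst.continuousOn fun q hq => hq.1

lemma continuousOn_formComp {φ : ∀ x : M, TangentSpace I x →ₗ[ℂ] ℂ}
    (hφ : φ ∈ holomorphicOneForms I M) (p : M) :
    ContinuousOn (fun q : E × E => formComp φ p q.2 q.1) ((extChartAt I p).target ×ˢ univ) := by
  set b := Module.finBasis ℂ E
  have hb : ∀ i, Continuous fun u : E => b.repr u i := fun i =>
    (b.coord i).continuous_of_finiteDimensional
  have heq : ∀ q : E × E, formComp φ p q.2 q.1 = ∑ i, b.repr q.2 i * formComp φ p (b i) q.1 := by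
    intro q
    simp only [formComp]
    conv_lhs => rw [← b.sum_repr q.2]
    simp only [map_sum, map_smul, smul_eq_mul]
  simp only [heq]
  refine continuousOn_finsetSum _ fun i _ => ((hb i).comp continuous_snd).continuousOn.mul ?_
  exact (hφ p _).continuousOn.comp continuous_fst.continuousOn fun q hq => hq.1

/-- Comparison of quadratic quantities on a compact set of base points. -/
lemma exists_le_mul_of_homogeneous {K T : Set E} (hK : IsCompact K) (hKT : K ⊆ T)
    {F G : E → E → ℝ}
    (hF : ContinuousOn (fun q : E × E => F q.1 q.2) (T ×ˢ univ))
    (hG : ContinuousOn (fun q : E × E => G q.1 q.2) (T ×ˢ univ))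
    (hFh : ∀ z u, ∀ c : ℂ, F z (c • u) = ‖c‖ ^ 2 * F z u)
    (hGh : ∀ z u, ∀ c : ℂ, G z (c • u) = ‖c‖ ^ 2 * G z u)
    (hpos : ∀ z ∈ K, ∀ u, u ≠ 0 → 0 < G z u) :
    ∃ C : ℝ, 0 < C ∧ ∀ z ∈ K, ∀ u, F z u ≤ C * G z u := by
  have hproper : ProperSpace E := FiniteDimensional.proper ℂ E
  have hsub : K ×ˢ sphere (0 : E) 1 ⊆ T ×ˢ univ := prod_mono hKT (subset_univ _)
  have hpos' : ∀ q ∈ K ×ˢ sphere (0 : E) 1, 0 < G q.1 q.2 := fun q hq =>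
    hpos _ hq.1 _ (ne_of_mem_sphere hq.2 one_ne_zero)
  obtain ⟨C, hC⟩ := (hK.prod (isCompact_sphere (0 : E) 1)).bddAbove_image
    ((hF.mono hsub).div (hG.mono hsub) fun q hq => (hpos' q hq).ne')
  refine ⟨max C 1, by positivity, fun z hz u => ?_⟩
  by_cases hu : u = 0
  · have h1 := hFh z 0 0
    have h2 := hGh z 0 0
    simp only [smul_zero, norm_zero, ne_eq, OfNat.ofNat_ne_zero, not_false_eq_true, zero_pow,
      zero_mul] at h1 h2
    rw [hu, h1, h2, mul_zero]
  have hun : 0 < ‖u‖ := norm_pos_iff.mpr hu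
  set w : E := ((‖u‖⁻¹ : ℝ) : ℂ) • u with hw
  have huw : u = ((‖u‖ : ℝ) : ℂ) • w := by
    rw [hw, smul_smul, ← Complex.ofReal_mul, mul_inv_cancel₀ hun.ne', Complex.ofReal_one, one_smul]
  have hws : w ∈ sphere (0 : E) 1 := by
    rw [mem_sphere_zero_iff_norm, hw, norm_smul, Complex.norm_real, norm_inv, norm_norm,
      inv_mul_cancel₀ hun.ne']
  have hmem : (z, w) ∈ K ×ˢ sphere (0 : E) 1 := ⟨hz, hws⟩
  have h1 : F z w / G z w ≤ max C 1 := (hC (mem_image_of_mem _ hmem)).trans (le_max_left _ _)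
  have h2 : F z w ≤ max C 1 * G z w := (div_le_iff₀ (hpos' _ hmem)).mp h1
  rw [huw, hFh, hGh, mul_left_comm]
  gcongr

variable [I.Boundaryless] [IsManifold I 1 M]

/-- A holomorphic `1`-form is locally bounded. -/
lemma exists_nhds_norm_sq_le {h : SesqField I M} (hh : IsHermitianMetric h)
    {φ : ∀ x : M, TangentSpace I x →ₗ[ℂ] ℂ} (hφ : φ ∈ holomorphicOneForms I M) (p : M) :
    ∃ U ∈ 𝓝 p, ∃ C : ℝ, ∀ x ∈ U, ∀ u : TangentSpace I x, ‖φ x u‖ ^ 2 ≤ C * (h x u u).re := by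
  have hproper : ProperSpace E := FiniteDimensional.proper ℂ E
  obtain ⟨R, hR, hball⟩ := Metric.nhds_basis_closedBall.mem_iff.mp
    ((isOpen_extChartAt_target (I := I) p).mem_nhds (mem_extChartAt_target p))
  obtain ⟨C, -, hC⟩ := exists_le_mul_of_homogeneous (isCompact_closedBall _ R) hball
    (F := fun z u => ‖formComp φ p u z‖ ^ 2) (G := fun z u => (comp h p u u z).re)
    ((continuousOn_formComp hφ p).norm.pow 2)
    (Complex.continuous_re.comp_continuousOn (continuousOn_comp_diag hh p))
    (norm_sq_formComp_smul φ p) (comp_smul_smul_re h p) (fun z hz u => hh.comp_pos (hball hz))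
  refine ⟨(extChartAt I p).source ∩ extChartAt I p ⁻¹' closedBall (extChartAt I p p) R,
    inter_mem (extChartAt_source_mem_nhds p)
      ((continuousAt_extChartAt p).preimage_mem_nhds (closedBall_mem_nhds _ hR)), C, ?_⟩
  exact forall_of_target (P := fun x u => ‖φ x u‖ ^ 2 ≤ C * (h x u u).re) hball hC

/-- The Schwarz lemma for holomorphic `1`-forms vanishing at a point. -/
lemma exists_nhds_norm_sq_le_half {h : SesqField I M} (hh : IsHermitianMetric h) (p : M) :
    ∃ U ∈ 𝓝 p, ∀ φ ∈ holomorphicOneForms I M, φ p = 0 → ∀ A : ℝ, 0 ≤ A →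
      (∀ x, ∀ u : TangentSpace I x, ‖φ x u‖ ^ 2 ≤ A * (h x u u).re) →
      ∀ x ∈ U, ∀ u : TangentSpace I x, ‖φ x u‖ ^ 2 ≤ A / 2 * (h x u u).re := by
  have hproper : ProperSpace E := FiniteDimensional.proper ℂ E
  set z₀ := extChartAt I p p with hz₀
  obtain ⟨R, hR, hball⟩ := Metric.nhds_basis_closedBall.mem_iff.mp
    ((isOpen_extChartAt_target (I := I) p).mem_nhds (mem_extChartAt_target p))
  have hKc := isCompact_closedBall z₀ R
  have hn : ContinuousOn (fun q : E × E => ‖q.2‖ ^ 2) ((extChartAt I p).target ×ˢ univ) := by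
    fun_prop
  have hnh : ∀ (_ u : E) (c : ℂ), ‖c • u‖ ^ 2 = ‖c‖ ^ 2 * ‖u‖ ^ 2 := fun _ u c => by
    rw [norm_smul, mul_pow]
  have hc := Complex.continuous_re.comp_continuousOn (continuousOn_comp_diag hh p)
  -- `C` and `D` compare `h` with the flat norm in both directions, over the same compact ball.
  obtain ⟨C, hC0, hC⟩ := exists_le_mul_of_homogeneous hKc hball
    (F := fun _ u => ‖u‖ ^ 2) (G := fun z u => (comp h p u u z).re) hn hc hnh
    (comp_smul_smul_re h p) (fun z hz u => hh.comp_pos (hball hz))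
  obtain ⟨D, hD0, hD⟩ := exists_le_mul_of_homogeneous hKc hball
    (F := fun z u => (comp h p u u z).re) (G := fun _ u => ‖u‖ ^ 2) hc hn
    (comp_smul_smul_re h p) hnh (fun z hz u hu => by positivity)
  -- Makes `D * C * (r / R) ^ 2 ≤ 1 / 2`. It depends on `h` and `p` only, so one neighbourhood
  -- serves all forms `φ` and all bounds `A`.
  set r := R / (2 * (1 + C * D)) with hrdef
  have hr : 0 < r := by positivity
  have hrR : r < R := by
    rw [hrdef]
    refine div_lt_self hR ?_
    have : 0 < C * D := by positivity
    linarith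
  have hCD : D * C * (r / R) ^ 2 ≤ 1 / 2 := by
    have h1 : r / R = 1 / (2 * (1 + C * D)) := by rw [hrdef]; field_simp
    rw [h1, div_pow, one_pow, mul_one_div, div_le_iff₀ (by positivity)]
    have : 0 < C * D := by positivity
    nlinarith
  refine ⟨(extChartAt I p).source ∩ extChartAt I p ⁻¹' closedBall z₀ r,
    inter_mem (extChartAt_source_mem_nhds p)
      ((continuousAt_extChartAt p).preimage_mem_nhds (closedBall_mem_nhds _ hr)), ?_⟩
  intro φ hφ hφp A hA hbound
  have hrR' : closedBall z₀ r ⊆ closedBall z₀ R := closedBall_subset_closedBall hrR.le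
  refine forall_of_target (P := fun x u => ‖φ x u‖ ^ 2 ≤ A / 2 * (h x u u).re)
    (hrR'.trans hball) fun z hz u => ?_
  change ‖formComp φ p u z‖ ^ 2 ≤ A / 2 * (comp h p u u z).re
  set S := Real.sqrt (A * (D * ‖u‖ ^ 2)) with hS
  have hf0 : formComp φ p u z₀ = 0 := by
    have h1 : (extChartAt I p).symm z₀ = p := extChartAt_to_inv p
    have h2 : φ ((extChartAt I p).symm z₀) = 0 := by rw [h1]; exact hφp
    simp only [formComp, h2, LinearMap.zero_apply]
  have hmaps : MapsTo (formComp φ p u) (ball z₀ R) (closedBall (formComp φ p u z₀) S) := by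
    intro y hy
    rw [hf0, mem_closedBall_zero_iff]
    refine Real.le_sqrt_of_sq_le ?_
    calc ‖formComp φ p u y‖ ^ 2 ≤ A * (comp h p u u y).re := hbound _ _
      _ ≤ A * (D * ‖u‖ ^ 2) := by gcongr; exact hD y (ball_subset_closedBall hy) u
  have hzR : z ∈ ball z₀ R := closedBall_subset_ball hrR hz
  -- The coefficient vanishes at the centre and is bounded by `S` on the ball, so it gains a factor
  -- `r / R` on the smaller ball.
  have hschwarz := Complex.dist_le_div_mul_dist_of_mapsTo_ball
    ((hφ p u).mono (ball_subset_closedBall.trans hball)) hmaps hzR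
  change dist (formComp φ p u z) (formComp φ p u z₀) ≤ _ at hschwarz
  rw [hf0, dist_zero_right] at hschwarz
  have h1 : ‖formComp φ p u z‖ ≤ S * (r / R) := by
    calc _ ≤ S / R * dist z z₀ := hschwarz
      _ ≤ S / R * r := by gcongr; exact hz
      _ = S * (r / R) := by ring
  have hcomp0 : 0 ≤ (comp h p u u z).re :=
    nonneg_of_mul_nonneg_right ((sq_nonneg ‖u‖).trans (hC z (hrR' hz) u)) hC0
  calc ‖formComp φ p u z‖ ^ 2 ≤ (S * (r / R)) ^ 2 := by gcongr
    _ = A * (D * ‖u‖ ^ 2) * (r / R) ^ 2 := by rw [mul_pow, hS, Real.sq_sqrt (by positivity)]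
    _ ≤ A * (D * (C * (comp h p u u z).re)) * (r / R) ^ 2 := by
        gcongr; exact hC z (hrR' hz) u
    _ = A * (comp h p u u z).re * (D * C * (r / R) ^ 2) := by ring
    _ ≤ A * (comp h p u u z).re * (1 / 2) := by gcongr
    _ = A / 2 * (comp h p u u z).re := by ring

/-- The space of holomorphic `1`-forms on a compact complex manifold carrying a Hermitian metric is
finite-dimensional. -/
theorem finite_holomorphicOneForms [CompactSpace M] {h : SesqField I M}
    (hh : IsHermitianMetric h) : Module.Finite ℂ (holomorphicOneForms I M) := by
  choose U hU hhalf using fun p : M => exists_nhds_norm_sq_le_half hh p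
  obtain ⟨t, ht⟩ := isCompact_univ.elim_nhds_subcover U fun p _ => hU p
  have hnonneg : ∀ x, ∀ u : TangentSpace I x, 0 ≤ (h x u u).re := fun x u => by
    by_cases hu : u = 0
    · rw [hu, map_zero]
      exact le_rfl
    · exact (hh.pos x u hu).le
  have hfin : ∀ x : M, FiniteDimensional ℂ (TangentSpace I x) := fun x =>
    inferInstanceAs (FiniteDimensional ℂ E)
  -- A form is determined by its values at the finitely many centres of the cover: if they vanish,
  -- any global bound can be halved indefinitely.
  let ev : holomorphicOneForms I M →ₗ[ℂ] (∀ p : t, TangentSpace I (p : M) →ₗ[ℂ] ℂ) :=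
    { toFun := fun φ p => φ.1 p
      map_add' := fun _ _ => rfl
      map_smul' := fun _ _ => rfl }
  refine Module.Finite.of_injective ev ((injective_iff_map_eq_zero ev).mpr ?_)
  rintro ⟨φ, hφ⟩ hev
  have hvan : ∀ p ∈ t, φ p = 0 := fun p hp => congrFun hev ⟨p, hp⟩
  obtain ⟨A, hA, hbound⟩ : ∃ A : ℝ, 0 ≤ A ∧
      ∀ x, ∀ u : TangentSpace I x, ‖φ x u‖ ^ 2 ≤ A * (h x u u).re := by
    choose V hV B hB using fun p : M => exists_nhds_norm_sq_le hh hφ p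
    obtain ⟨t', ht'⟩ := isCompact_univ.elim_nhds_subcover V fun p _ => hV p
    refine ⟨∑ p ∈ t', |B p|, Finset.sum_nonneg fun p _ => abs_nonneg _, fun x u => ?_⟩
    obtain ⟨p, hp, hx⟩ := mem_iUnion₂.mp (ht'.2 (mem_univ x))
    refine (hB p x hx u).trans (mul_le_mul_of_nonneg_right ?_ (hnonneg x u))
    exact (le_abs_self _).trans
      (Finset.single_le_sum (f := fun p => |B p|) (fun p _ => abs_nonneg _) hp)
  have hiter : ∀ n : ℕ, ∀ x, ∀ u : TangentSpace I x,
      ‖φ x u‖ ^ 2 ≤ A * (1 / 2) ^ n * (h x u u).re := by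
    intro n
    induction n with
    | zero => simpa using hbound
    | succ n ih =>
      intro x u
      obtain ⟨p, hp, hx⟩ := mem_iUnion₂.mp (ht.2 (mem_univ x))
      have := hhalf p φ hφ (hvan p hp) _ (by positivity) ih x hx u
      rwa [pow_succ (1 / 2 : ℝ) n, ← mul_assoc, mul_one_div]
  have hzero : ∀ x, ∀ u : TangentSpace I x, φ x u = 0 := fun x u => by
    have hlim : Tendsto (fun n : ℕ => A * (1 / 2 : ℝ) ^ n * (h x u u).re) atTop
        (𝓝 (A * 0 * (h x u u).re)) :=
      ((tendsto_pow_atTop_nhds_zero_of_lt_one (by norm_num) (by norm_num)).const_mul A).mul_const _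
    have h1 := ge_of_tendsto' hlim fun n => hiter n x u
    rw [mul_zero, zero_mul] at h1
    exact norm_eq_zero.mp (pow_eq_zero_iff two_ne_zero |>.mp (le_antisymm h1 (sq_nonneg _)))
  exact Subtype.ext (funext fun x => LinearMap.ext (hzero x))

end Finiteness

end OneForms

end HermitianProduct

end

/-! ### Fields on a product and their components -/

noncomputable section

namespace HermitianProduct

open Set Metric Filter Topology ComplexConjugate

lemma dHol_dBar_comp {E E' : Type*} [NormedAddCommGroup E] [NormedSpace ℂ E]
    [NormedAddCommGroup E'] [NormedSpace ℂ E'] {f : E' → ℂ} {g : E → E'} {A : E →L[ℂ] E'}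
    (hg : ∀ z, HasFDerivAt g A z) {z : E} (hf : ContDiffAt ℝ 2 f (g z)) (v : E) :
    dHol v (dBar v (fun z => f (g z))) z = dHol (A v) (dBar (A v) f) (g z) := by
  have h1 : dBar v (fun z => f (g z)) =ᶠ[𝓝 z] fun y => dBar (A v) f (g y) := by
    filter_upwards [(hg z).continuousAt.tendsto.eventually (hf.eventually (by simp))] with y hy
    exact dBar_comp (hg y) (hy.differentiableAt (by simp)) v
  rw [dHol_congr h1, dHol_comp (hg z) (differentiableAt_dBar hf _)]

/-- The pullback of a sesquilinear form by a linear map. -/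
def sesqPullback {V W : Type*} [AddCommGroup V] [Module ℂ V] [AddCommGroup W] [Module ℂ W]
    (s : V →ₗ[ℂ] V →ₗ⋆[ℂ] ℂ) (f : W →ₗ[ℂ] V) : W →ₗ[ℂ] W →ₗ⋆[ℂ] ℂ :=
  LinearMap.mk₂'ₛₗ (RingHom.id ℂ) (starRingEnd ℂ) (fun u v => s (f u) (f v))
    (fun u u' v => by rw [map_add, map_add, LinearMap.add_apply])
    (fun c u v => by rw [map_smul, map_smul, LinearMap.smul_apply]; rfl)
    (fun u v v' => by rw [map_add, map_add])
    (fun c u v => by rw [map_smul, LinearMap.map_smulₛₗ])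

lemma sesq_prod_apply {V W : Type*} [AddCommGroup V] [Module ℂ V] [AddCommGroup W] [Module ℂ W]
    (s : (V × W) →ₗ[ℂ] (V × W) →ₗ⋆[ℂ] ℂ) (u u' : V) (v v' : W) :
    s (u, v) (u', v') = s (u, 0) (u', 0) + s (u, 0) (0, v')
      + (s (0, v) (u', 0) + s (0, v) (0, v')) := by
  have h1 : ∀ (u : V) (v : W), (u, v) = (u, 0) + (0, v) := fun u v => by simp
  rw [h1 u v, h1 u' v', map_add, map_add, LinearMap.add_apply, LinearMap.add_apply]
  ring

/-- Complex polarization: the diagonal at `u + v` and at `u + I • v` determines both the sum and the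
difference of `d u v` and `d v u`. -/
lemma sesq_eq_of_diag {V : Type*} [AddCommGroup V] [Module ℂ V] {s t : V →ₗ[ℂ] V →ₗ⋆[ℂ] ℂ}
    (h : ∀ u, s u u = t u u) : s = t := by
  rw [← sub_eq_zero]
  have hd : ∀ u, (s - t) u u = 0 := fun u => by
    rw [LinearMap.sub_apply, LinearMap.sub_apply, h, sub_self]
  generalize s - t = d at hd
  have h1 : ∀ u v, d u v + d v u = 0 := fun u v => by
    have := hd (u + v)
    simp only [map_add, LinearMap.add_apply, hd] at this
    linear_combination this
  refine LinearMap.ext₂ fun u v => ?_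
  have h2 := h1 u (Complex.I • v)
  simp only [map_smul, LinearMap.smul_apply, LinearMap.map_smulₛₗ, Complex.conj_I,
    smul_eq_mul] at h2
  have h3 : 2 * d u v = 0 := by
    linear_combination h1 u v + Complex.I * h2 + (d u v - d v u) * Complex.I_mul_I
  simpa using h3

section Product

variable {E₁ E₂ : Type*} [NormedAddCommGroup E₁] [NormedSpace ℂ E₁]
  [NormedAddCommGroup E₂] [NormedSpace ℂ E₂]
  {M₁ M₂ : Type*} [TopologicalSpace M₁] [ChartedSpace E₁ M₁]
  [TopologicalSpace M₂] [ChartedSpace E₂ M₂]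

lemma productField_apply (h₁ : SesqField 𝓘(ℂ, E₁) M₁) (h₂ : SesqField 𝓘(ℂ, E₂) M₂) (q : M₁ × M₂)
    (U V : TangentSpace (𝓘(ℂ, E₁).prod 𝓘(ℂ, E₂)) q) :
    productField 𝓘(ℂ, E₁) 𝓘(ℂ, E₂) M₁ M₂ (h₁, h₂) q U V =
      h₁ q.1 U.1 V.1 + h₂ q.2 U.2 V.2 := by
  change h₁ q.1 (mfderiv (𝓘(ℂ, E₁).prod 𝓘(ℂ, E₂)) 𝓘(ℂ, E₁) Prod.fst q U)
      (mfderiv (𝓘(ℂ, E₁).prod 𝓘(ℂ, E₂)) 𝓘(ℂ, E₁) Prod.fst q V) +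
    h₂ q.2 (mfderiv (𝓘(ℂ, E₁).prod 𝓘(ℂ, E₂)) 𝓘(ℂ, E₂) Prod.snd q U)
      (mfderiv (𝓘(ℂ, E₁).prod 𝓘(ℂ, E₂)) 𝓘(ℂ, E₂) Prod.snd q V) = _
  rw [mfderiv_fst, mfderiv_snd]
  rfl

lemma mem_extChartAt_prod_target {p : M₁ × M₂} {z : E₁ × E₂} :
    z ∈ (extChartAt (𝓘(ℂ, E₁).prod 𝓘(ℂ, E₂)) p).target ↔
      z.1 ∈ (extChartAt 𝓘(ℂ, E₁) p.1).target ∧ z.2 ∈ (extChartAt 𝓘(ℂ, E₂) p.2).target := by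
  rw [extChartAt_prod]
  exact Iff.rfl

/-- The fields of linear forms `φ(U) + ψ(V)` on the product. -/
def prodForm (φ : ∀ x : M₁, TangentSpace 𝓘(ℂ, E₁) x →ₗ[ℂ] ℂ)
    (ψ : ∀ y : M₂, TangentSpace 𝓘(ℂ, E₂) y →ₗ[ℂ] ℂ) :
    ∀ q : M₁ × M₂, TangentSpace (𝓘(ℂ, E₁).prod 𝓘(ℂ, E₂)) q →ₗ[ℂ] ℂ :=
  fun q => (LinearMap.coprod (φ q.1) (ψ q.2) : E₁ × E₂ →ₗ[ℂ] ℂ)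

lemma prodForm_apply (φ : ∀ x : M₁, TangentSpace 𝓘(ℂ, E₁) x →ₗ[ℂ] ℂ)
    (ψ : ∀ y : M₂, TangentSpace 𝓘(ℂ, E₂) y →ₗ[ℂ] ℂ) (q : M₁ × M₂)
    (U : TangentSpace (𝓘(ℂ, E₁).prod 𝓘(ℂ, E₂)) q) :
    prodForm φ ψ q U = φ q.1 U.1 + ψ q.2 U.2 := rfl

/-- The field on `M₂ × M₁` obtained from one on `M₁ × M₂` by exchanging the factors. -/
def swapField (h : SesqField (𝓘(ℂ, E₁).prod 𝓘(ℂ, E₂)) (M₁ × M₂)) :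
    SesqField (𝓘(ℂ, E₂).prod 𝓘(ℂ, E₁)) (M₂ × M₁) := fun q =>
  sesqPullback (V := E₁ × E₂) (W := E₂ × E₁) (h (q.2, q.1))
    ((LinearMap.snd ℂ E₂ E₁).prod (LinearMap.fst ℂ E₂ E₁))

lemma swapField_apply (h : SesqField (𝓘(ℂ, E₁).prod 𝓘(ℂ, E₂)) (M₁ × M₂)) (q : M₂ × M₁)
    (U V : TangentSpace (𝓘(ℂ, E₂).prod 𝓘(ℂ, E₁)) q) :
    swapField h q U V = h (q.2, q.1) (U.2, U.1) (V.2, V.1) := rfl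

/-- The restriction to the slice `M₁ × {y}`, a real linear function of the field. -/
def restrictFst (y : M₂) :
    SesqField (𝓘(ℂ, E₁).prod 𝓘(ℂ, E₂)) (M₁ × M₂) →ₗ[ℝ] SesqField 𝓘(ℂ, E₁) M₁ where
  toFun h := fun x =>
    sesqPullback (V := E₁ × E₂) (W := E₁) (h (x, y)) (LinearMap.inl ℂ E₁ E₂)
  map_add' _ _ := rfl
  map_smul' _ _ := rfl

lemma restrictFst_apply (h : SesqField (𝓘(ℂ, E₁).prod 𝓘(ℂ, E₂)) (M₁ × M₂)) (y : M₂) (x : M₁)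
    (U V : TangentSpace 𝓘(ℂ, E₁) x) : restrictFst y h x U V = h (x, y) (U, 0) (V, 0) := rfl

/-- The field of linear forms `V ↦ h((0, V), (U, 0))` on `M₂`, for a tangent vector `U` of `M₁`. -/
def mixedForm (h : SesqField (𝓘(ℂ, E₁).prod 𝓘(ℂ, E₂)) (M₁ × M₂)) (x : M₁)
    (U : TangentSpace 𝓘(ℂ, E₁) x) (y : M₂) : TangentSpace 𝓘(ℂ, E₂) y →ₗ[ℂ] ℂ :=
  ((h (x, y) : E₁ × E₂ →ₗ[ℂ] E₁ × E₂ →ₗ⋆[ℂ] ℂ).flip (U, 0)) ∘ₗ LinearMap.inr ℂ E₁ E₂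

lemma mixedForm_apply (h : SesqField (𝓘(ℂ, E₁).prod 𝓘(ℂ, E₂)) (M₁ × M₂)) (x : M₁)
    (U : TangentSpace 𝓘(ℂ, E₁) x) (y : M₂) (V : TangentSpace 𝓘(ℂ, E₂) y) :
    mixedForm h x U y V = h (x, y) (0, V) (U, 0) := rfl

lemma apply_eq_add (h : SesqField (𝓘(ℂ, E₁).prod 𝓘(ℂ, E₂)) (M₁ × M₂)) (x : M₁) (y : M₂)
    (U U' : TangentSpace 𝓘(ℂ, E₁) x) (V V' : TangentSpace 𝓘(ℂ, E₂) y) :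
    h (x, y) (U, V) (U', V') = h (x, y) (U, 0) (U', 0) + h (x, y) (U, 0) (0, V')
      + (h (x, y) (0, V) (U', 0) + h (x, y) (0, V) (0, V')) :=
  sesq_prod_apply (V := E₁) (W := E₂) (h (x, y)) U U' V V'

/-- Evaluation of the mixed components of a field at finitely many pairs of tangent vectors. -/
def mixedEval {ι κ : Type*} (X : ι → Σ p : M₁, TangentSpace 𝓘(ℂ, E₁) p)
    (Y : κ → Σ p : M₂, TangentSpace 𝓘(ℂ, E₂) p) :
    SesqField (𝓘(ℂ, E₁).prod 𝓘(ℂ, E₂)) (M₁ × M₂) →ₗ[ℝ] (ι → κ → ℂ) where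
  toFun h i j := mixedForm h (X i).1 (X i).2 (Y j).1 (Y j).2
  map_add' _ _ := rfl
  map_smul' _ _ := rfl

lemma mixedForm_productField (k : SesqField 𝓘(ℂ, E₁) M₁ × SesqField 𝓘(ℂ, E₂) M₂) (x : M₁)
    (U : TangentSpace 𝓘(ℂ, E₁) x) (y : M₂) (V : TangentSpace 𝓘(ℂ, E₂) y) :
    mixedForm (productField 𝓘(ℂ, E₁) 𝓘(ℂ, E₂) M₁ M₂ k) x U y V = 0 := by
  refine (productField_apply k.1 k.2 (x, y) (0, V) (U, 0)).trans ?_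
  have h1 : k.1 x 0 U = 0 := by rw [map_zero]; rfl
  have h2 : k.2 y V 0 = 0 := map_zero _
  exact (congrArg₂ (· + ·) h1 h2).trans (add_zero 0)

/-- Subtracting `φ ⊗ φ̄` and `ψ ⊗ ψ̄` removes the diagonal blocks of `(φ + ψ) ⊗ conj (φ + ψ)`, so a
pure tensor is a difference of two fields of the kind found in the cone. -/
lemma sub_rankOne_apply_mixed (h₁ : SesqField 𝓘(ℂ, E₁) M₁) (h₂ : SesqField 𝓘(ℂ, E₂) M₂)
    (φ : ∀ x : M₁, TangentSpace 𝓘(ℂ, E₁) x →ₗ[ℂ] ℂ)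
    (ψ : ∀ y : M₂, TangentSpace 𝓘(ℂ, E₂) y →ₗ[ℂ] ℂ) (x : M₁) (y : M₂)
    (U : TangentSpace 𝓘(ℂ, E₁) x) (V : TangentSpace 𝓘(ℂ, E₂) y) :
    mixedForm (productField 𝓘(ℂ, E₁) 𝓘(ℂ, E₂) M₁ M₂ (h₁, h₂) + rankOne (prodForm φ ψ)
      - productField 𝓘(ℂ, E₁) 𝓘(ℂ, E₂) M₁ M₂ (h₁ + rankOne φ, h₂ + rankOne ψ)) x U y V
      = ψ y V * conj (φ x U) := by
  change mixedForm (productField 𝓘(ℂ, E₁) 𝓘(ℂ, E₂) M₁ M₂ (h₁, h₂)) x U y V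
    + (φ x 0 + ψ y V) * conj (φ x U + ψ y 0)
    - mixedForm (productField 𝓘(ℂ, E₁) 𝓘(ℂ, E₂) M₁ M₂ (h₁ + rankOne φ, h₂ + rankOne ψ)) x U y V = _
  rw [mixedForm_productField, mixedForm_productField, map_zero, map_zero, zero_add, zero_add,
    add_zero, sub_zero]

lemma restrictFst_productField (k : SesqField 𝓘(ℂ, E₁) M₁ × SesqField 𝓘(ℂ, E₂) M₂) (y : M₂) :
    restrictFst y (productField 𝓘(ℂ, E₁) 𝓘(ℂ, E₂) M₁ M₂ k) = k.1 := by
  funext x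
  refine LinearMap.ext₂ fun U V => ?_
  refine (productField_apply k.1 k.2 (x, y) (U, 0) (V, 0)).trans ?_
  have h2 : k.2 y 0 0 = 0 := map_zero _
  exact (congrArg (k.1 x U V + ·) h2).trans (add_zero _)

/-- The restriction to the slice `{x} × M₂`. -/
def restrictSnd (x : M₁) :
    SesqField (𝓘(ℂ, E₁).prod 𝓘(ℂ, E₂)) (M₁ × M₂) →ₗ[ℝ] SesqField 𝓘(ℂ, E₂) M₂ where
  toFun h := restrictFst x (swapField h)
  map_add' _ _ := rfl
  map_smul' _ _ := rfl

lemma restrictSnd_productField (k : SesqField 𝓘(ℂ, E₁) M₁ × SesqField 𝓘(ℂ, E₂) M₂) (x : M₁) :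
    restrictSnd x (productField 𝓘(ℂ, E₁) 𝓘(ℂ, E₂) M₁ M₂ k) = k.2 := by
  funext y
  refine LinearMap.ext₂ fun U V => ?_
  refine (productField_apply k.1 k.2 (x, y) (0, U) (0, V)).trans ?_
  have h1 : k.1 x 0 0 = 0 := map_zero _
  exact (congrArg (· + k.2 y U V) h1).trans (zero_add _)

/-- Restriction to a slice of each kind recovers the two factors. -/
theorem productField_injective [Nonempty M₁] [Nonempty M₂] :
    Function.Injective (productField 𝓘(ℂ, E₁) 𝓘(ℂ, E₂) M₁ M₂) := by
  obtain ⟨x⟩ := ‹Nonempty M₁›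
  obtain ⟨y⟩ := ‹Nonempty M₂›
  intro k k' hk
  refine Prod.ext ?_ ?_
  · rw [← restrictFst_productField k y, hk, restrictFst_productField]
  · rw [← restrictSnd_productField k x, hk, restrictSnd_productField]

variable [IsManifold 𝓘(ℂ, E₁) 1 M₁] [IsManifold 𝓘(ℂ, E₂) 1 M₂]

lemma hasMFDerivAt_extChartAt_symm {p : M₁} {z : E₁} (hz : z ∈ (extChartAt 𝓘(ℂ, E₁) p).target) :
    HasMFDerivAt 𝓘(ℂ, E₁) 𝓘(ℂ, E₁) (extChartAt 𝓘(ℂ, E₁) p).symm z (coordVec 𝓘(ℂ, E₁) p z) := by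
  have := mdifferentiableWithinAt_extChartAt_symm hz
  rw [ModelWithCorners.range_eq_univ, mdifferentiableWithinAt_univ] at this
  exact this.hasMFDerivAt

/-- The preferred chart of a product is the product of the preferred charts, so its frame splits;
all component formulas on the product rest on this. -/
lemma coordVec_prod {p : M₁ × M₂} {z : E₁ × E₂} (hz₁ : z.1 ∈ (extChartAt 𝓘(ℂ, E₁) p.1).target)
    (hz₂ : z.2 ∈ (extChartAt 𝓘(ℂ, E₂) p.2).target) (u : E₁ × E₂) :
    coordVec (𝓘(ℂ, E₁).prod 𝓘(ℂ, E₂)) p z u =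
      (coordVec 𝓘(ℂ, E₁) p.1 z.1 u.1, coordVec 𝓘(ℂ, E₂) p.2 z.2 u.2) := by
  have h1 : HasMFDerivAt 𝓘(ℂ, E₁ × E₂) 𝓘(ℂ, E₁)
      (fun q : E₁ × E₂ => (extChartAt 𝓘(ℂ, E₁) p.1).symm q.1) z
      ((coordVec 𝓘(ℂ, E₁) p.1 z.1).comp (ContinuousLinearMap.fst ℂ E₁ E₂)) :=
    HasMFDerivAt.comp z (hasMFDerivAt_extChartAt_symm hz₁) hasFDerivAt_fst.hasMFDerivAt
  have h2 : HasMFDerivAt 𝓘(ℂ, E₁ × E₂) 𝓘(ℂ, E₂)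
      (fun q : E₁ × E₂ => (extChartAt 𝓘(ℂ, E₂) p.2).symm q.2) z
      ((coordVec 𝓘(ℂ, E₂) p.2 z.2).comp (ContinuousLinearMap.snd ℂ E₁ E₂)) :=
    HasMFDerivAt.comp z (hasMFDerivAt_extChartAt_symm hz₂) hasFDerivAt_snd.hasMFDerivAt
  have h3 : ((extChartAt (𝓘(ℂ, E₁).prod 𝓘(ℂ, E₂)) p).symm : E₁ × E₂ → M₁ × M₂) =
      fun q => ((extChartAt 𝓘(ℂ, E₁) p.1).symm q.1, (extChartAt 𝓘(ℂ, E₂) p.2).symm q.2) := by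
    rw [extChartAt_prod]; rfl
  have h4 := (h1.prodMk h2).mfderiv
  rw [← h3] at h4
  exact congrArg (fun L : E₁ × E₂ →L[ℂ] E₁ × E₂ => L u) h4

lemma comp_productField (h₁ : SesqField 𝓘(ℂ, E₁) M₁) (h₂ : SesqField 𝓘(ℂ, E₂) M₂) {p : M₁ × M₂}
    {z : E₁ × E₂} (hz : z ∈ (extChartAt (𝓘(ℂ, E₁).prod 𝓘(ℂ, E₂)) p).target) (u v : E₁ × E₂) :
    comp (productField 𝓘(ℂ, E₁) 𝓘(ℂ, E₂) M₁ M₂ (h₁, h₂)) p u v z =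
      comp h₁ p.1 u.1 v.1 z.1 + comp h₂ p.2 u.2 v.2 z.2 := by
  obtain ⟨hz₁, hz₂⟩ := mem_extChartAt_prod_target.mp hz
  rw [comp, productField_apply, coordVec_prod hz₁ hz₂, coordVec_prod hz₁ hz₂]
  rfl

lemma formComp_prodForm (φ : ∀ x : M₁, TangentSpace 𝓘(ℂ, E₁) x →ₗ[ℂ] ℂ)
    (ψ : ∀ y : M₂, TangentSpace 𝓘(ℂ, E₂) y →ₗ[ℂ] ℂ) {p : M₁ × M₂}
    {z : E₁ × E₂} (hz : z ∈ (extChartAt (𝓘(ℂ, E₁).prod 𝓘(ℂ, E₂)) p).target) (u : E₁ × E₂) :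
    formComp (prodForm φ ψ) p u z = formComp φ p.1 u.1 z.1 + formComp ψ p.2 u.2 z.2 := by
  obtain ⟨hz₁, hz₂⟩ := mem_extChartAt_prod_target.mp hz
  rw [formComp, prodForm_apply, coordVec_prod hz₁ hz₂]
  rfl

lemma comp_swapField (h : SesqField (𝓘(ℂ, E₁).prod 𝓘(ℂ, E₂)) (M₁ × M₂)) {p : M₂ × M₁}
    {z : E₂ × E₁} (hz : z ∈ (extChartAt (𝓘(ℂ, E₂).prod 𝓘(ℂ, E₁)) p).target) (u v : E₂ × E₁) :
    comp (swapField h) p u v z = comp h p.swap u.swap v.swap z.swap := by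
  obtain ⟨hz₁, hz₂⟩ := mem_extChartAt_prod_target.mp hz
  rw [comp, swapField_apply, coordVec_prod hz₁ hz₂, coordVec_prod hz₁ hz₂, comp]
  have h1 : ∀ u : E₂ × E₁, coordVec (𝓘(ℂ, E₁).prod 𝓘(ℂ, E₂)) p.swap z.swap u.swap = _ :=
    fun u => coordVec_prod (p := p.swap) (z := z.swap) hz₂ hz₁ u.swap
  rw [h1, h1]
  rfl

lemma comp_restrictFst (h : SesqField (𝓘(ℂ, E₁).prod 𝓘(ℂ, E₂)) (M₁ × M₂)) {p : M₁ × M₂}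
    {z : E₁ × E₂} (hz : z ∈ (extChartAt (𝓘(ℂ, E₁).prod 𝓘(ℂ, E₂)) p).target) (u v : E₁) :
    comp (restrictFst ((extChartAt 𝓘(ℂ, E₂) p.2).symm z.2) h) p.1 u v z.1 =
      comp h p (u, 0) (v, 0) z := by
  obtain ⟨hz₁, hz₂⟩ := mem_extChartAt_prod_target.mp hz
  rw [comp, restrictFst_apply, comp, coordVec_prod hz₁ hz₂, coordVec_prod hz₁ hz₂, map_zero]
  rfl

lemma formComp_mixedForm (h : SesqField (𝓘(ℂ, E₁).prod 𝓘(ℂ, E₂)) (M₁ × M₂)) {p : M₁ × M₂}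
    {z : E₁ × E₂} (hz : z ∈ (extChartAt (𝓘(ℂ, E₁).prod 𝓘(ℂ, E₂)) p).target) (u : E₁) (v : E₂) :
    formComp (mixedForm h ((extChartAt 𝓘(ℂ, E₁) p.1).symm z.1) (coordVec 𝓘(ℂ, E₁) p.1 z.1 u))
      p.2 v z.2 = comp h p (0, v) (u, 0) z := by
  obtain ⟨hz₁, hz₂⟩ := mem_extChartAt_prod_target.mp hz
  rw [formComp, mixedForm_apply, comp, coordVec_prod hz₁ hz₂, coordVec_prod hz₁ hz₂, map_zero,
    map_zero]
  rfl

theorem prodForm_mem_holomorphicOneForms {φ : ∀ x : M₁, TangentSpace 𝓘(ℂ, E₁) x →ₗ[ℂ] ℂ}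
    {ψ : ∀ y : M₂, TangentSpace 𝓘(ℂ, E₂) y →ₗ[ℂ] ℂ} (hφ : φ ∈ holomorphicOneForms 𝓘(ℂ, E₁) M₁)
    (hψ : ψ ∈ holomorphicOneForms 𝓘(ℂ, E₂) M₂) :
    prodForm φ ψ ∈ holomorphicOneForms (𝓘(ℂ, E₁).prod 𝓘(ℂ, E₂)) (M₁ × M₂) := by
  intro p u
  refine DifferentiableOn.congr ?_ fun z hz => formComp_prodForm φ ψ hz u
  refine ((hφ p.1 u.1).comp differentiableOn_fst fun z hz => ?_).add
    ((hψ p.2 u.2).comp differentiableOn_snd fun z hz => ?_)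
  · exact (mem_extChartAt_prod_target.mp hz).1
  · exact (mem_extChartAt_prod_target.mp hz).2

end Product

end HermitianProduct

end

/-! ### Stability of the cone and rigidity along the factors -/

noncomputable section

namespace HermitianProduct

open Set Metric Filter Topology ComplexConjugate

lemma IsHermitianMetric.nonneg {E H : Type*} [NormedAddCommGroup E] [NormedSpace ℂ E]
    [TopologicalSpace H] {I : ModelWithCorners ℂ E H} {M : Type*} [TopologicalSpace M]
    [ChartedSpace H M] {h : SesqField I M} (hh : IsHermitianMetric h) (x : M)
    (u : TangentSpace I x) : 0 ≤ (h x u u).re := by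
  by_cases hu : u = 0
  · rw [hu, map_zero]
    exact le_rfl
  · exact (hh.pos x u hu).le

section Product

variable {E₁ E₂ : Type*} [NormedAddCommGroup E₁] [NormedSpace ℂ E₁] [FiniteDimensional ℂ E₁]
  [NormedAddCommGroup E₂] [NormedSpace ℂ E₂] [FiniteDimensional ℂ E₂]
  {M₁ M₂ : Type*} [TopologicalSpace M₁] [ChartedSpace E₁ M₁] [IsManifold 𝓘(ℂ, E₁) 1 M₁]
  [TopologicalSpace M₂] [ChartedSpace E₂ M₂] [IsManifold 𝓘(ℂ, E₂) 1 M₂]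

/-- The inequality on the product is the sum of the inequalities on the factors, at the respective
components of `u`, `v`, `e`. -/
theorem productField_mem_nonposMetrics {h₁ : SesqField 𝓘(ℂ, E₁) M₁} {h₂ : SesqField 𝓘(ℂ, E₂) M₂}
    (hh₁ : h₁ ∈ nonposMetrics 𝓘(ℂ, E₁) M₁) (hh₂ : h₂ ∈ nonposMetrics 𝓘(ℂ, E₂) M₂) :
    productField 𝓘(ℂ, E₁) 𝓘(ℂ, E₂) M₁ M₂ (h₁, h₂) ∈
      nonposMetrics (𝓘(ℂ, E₁).prod 𝓘(ℂ, E₂)) (M₁ × M₂) := by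
  rw [mem_nonposMetrics_iff] at hh₁ hh₂ ⊢
  obtain ⟨hm₁, hc₁⟩ := hh₁
  obtain ⟨hm₂, hc₂⟩ := hh₂
  refine ⟨⟨fun q U V => ?_, fun q U hU => ?_, fun p u v => ?_⟩, fun p z hz u v e => ?_⟩
  · rw [productField_apply, productField_apply, map_add]
    exact congrArg₂ (· + ·) (hm₁.hermitian _ _ _) (hm₂.hermitian _ _ _)
  · rw [productField_apply, Complex.add_re]
    by_cases h1 : U.1 = 0
    · have h2 : U.2 ≠ 0 := fun h2 => hU (Prod.ext h1 h2)
      have := hm₂.pos q.2 U.2 h2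
      have := hm₁.nonneg q.1 U.1
      linarith
    · have := hm₁.pos q.1 U.1 h1
      have := hm₂.nonneg q.2 U.2
      linarith
  · refine ContDiffOn.congr ?_ fun z hz => comp_productField h₁ h₂ hz u v
    refine ((hm₁.smooth p.1 u.1 v.1).comp contDiff_fst.contDiffOn fun z hz => ?_).add
      ((hm₂.smooth p.2 u.2 v.2).comp contDiff_snd.contDiffOn fun z hz => ?_)
    · exact (mem_extChartAt_prod_target.mp hz).1
    · exact (mem_extChartAt_prod_target.mp hz).2
  · obtain ⟨hz₁, hz₂⟩ := mem_extChartAt_prod_target.mp hz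
    have hev : ∀ u v : E₁ × E₂, comp (productField 𝓘(ℂ, E₁) 𝓘(ℂ, E₂) M₁ M₂ (h₁, h₂)) p u v =ᶠ[𝓝 z]
        fun z => comp h₁ p.1 u.1 v.1 z.1 + comp h₂ p.2 u.2 v.2 z.2 := fun u v => by
      filter_upwards [(isOpen_extChartAt_target p).mem_nhds hz] with y hy
      exact comp_productField h₁ h₂ hy u v
    have hfst : ∀ z : E₁ × E₂, HasFDerivAt Prod.fst (ContinuousLinearMap.fst ℂ E₁ E₂) z :=
      fun z => hasFDerivAt_fst
    have hsnd : ∀ z : E₁ × E₂, HasFDerivAt Prod.snd (ContinuousLinearMap.snd ℂ E₁ E₂) z :=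
      fun z => hasFDerivAt_snd
    have hd₁ : ∀ u v : E₁, ContDiffAt ℝ 2 (fun z : E₁ × E₂ => comp h₁ p.1 u v z.1) z := fun u v =>
      (hm₁.contDiffAt_two hz₁ u v).comp z contDiffAt_fst
    have hd₂ : ∀ u v : E₂, ContDiffAt ℝ 2 (fun z : E₁ × E₂ => comp h₂ p.2 u v z.2) z := fun u v =>
      (hm₂.contDiffAt_two hz₂ u v).comp z contDiffAt_snd
    have hdd₁ : ∀ u v : E₁, DifferentiableAt ℝ (fun z : E₁ × E₂ => comp h₁ p.1 u v z.1) z :=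
      fun u v => (hd₁ u v).differentiableAt (by simp)
    have hdd₂ : ∀ u v : E₂, DifferentiableAt ℝ (fun z : E₁ × E₂ => comp h₂ p.2 u v z.2) z :=
      fun u v => (hd₂ u v).differentiableAt (by simp)
    have hsum : dBar v (fun z => comp h₁ p.1 u.1 u.1 z.1 + comp h₂ p.2 u.2 u.2 z.2) =ᶠ[𝓝 z]
        fun z => dBar v (fun z : E₁ × E₂ => comp h₁ p.1 u.1 u.1 z.1) z
          + dBar v (fun z : E₁ × E₂ => comp h₂ p.2 u.2 u.2 z.2) z := by
      filter_upwards [(hd₁ u.1 u.1).eventually (by simp), (hd₂ u.2 u.2).eventually (by simp)]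
        with y hy₁ hy₂
      exact dBar_add (hy₁.differentiableAt (by simp)) (hy₂.differentiableAt (by simp)) v
    rw [dBar_congr (hev e u), dHol_dBar_congr (hev u u), dHol_congr hsum,
      dBar_add (hdd₁ _ _) (hdd₂ _ _),
      dHol_add (differentiableAt_dBar (hd₁ _ _) v) (differentiableAt_dBar (hd₂ _ _) v),
      (hev e e).self_of_nhds, dBar_comp (hfst z) (hm₁.differentiableAt hz₁ _ _),
      dBar_comp (hsnd z) (hm₂.differentiableAt hz₂ _ _),
      dHol_dBar_comp hfst (hm₁.contDiffAt_two hz₁ _ _),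
      dHol_dBar_comp hsnd (hm₂.contDiffAt_two hz₂ _ _)]
    have h1 := hc₁ p.1 z.1 hz₁ u.1 v.1 e.1
    have h2 := hc₂ p.2 z.2 hz₂ u.2 v.2 e.2
    simp only [Complex.add_re, ContinuousLinearMap.coe_fst', ContinuousLinearMap.coe_snd']
    linarith

/-- This lets every statement proved along one factor be used along the other. -/
theorem swapField_mem_nonposMetrics {h : SesqField (𝓘(ℂ, E₁).prod 𝓘(ℂ, E₂)) (M₁ × M₂)}
    (hh : h ∈ nonposMetrics (𝓘(ℂ, E₁).prod 𝓘(ℂ, E₂)) (M₁ × M₂)) :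
    swapField h ∈ nonposMetrics (𝓘(ℂ, E₂).prod 𝓘(ℂ, E₁)) (M₂ × M₁) := by
  rw [mem_nonposMetrics_iff] at hh ⊢
  obtain ⟨hm, hc⟩ := hh
  have hmem : ∀ {p : M₂ × M₁} {z : E₂ × E₁},
      z ∈ (extChartAt (𝓘(ℂ, E₂).prod 𝓘(ℂ, E₁)) p).target →
      z.swap ∈ (extChartAt (𝓘(ℂ, E₁).prod 𝓘(ℂ, E₂)) p.swap).target := fun hz =>
    mem_extChartAt_prod_target.mpr (mem_extChartAt_prod_target.mp hz).symm
  refine ⟨⟨fun q U V => ?_, fun q U hU => ?_, fun p u v => ?_⟩, fun p z hz u v e => ?_⟩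
  · exact hm.hermitian _ _ _
  · rw [swapField_apply]
    exact hm.pos _ _ fun h0 => hU (Prod.ext (congrArg Prod.snd h0) (congrArg Prod.fst h0))
  · refine ContDiffOn.congr ?_ fun z hz => comp_swapField h hz u v
    exact (hm.smooth p.swap u.swap v.swap).comp (contDiff_snd.prodMk contDiff_fst).contDiffOn
      fun z hz => hmem hz
  · have hev : ∀ u v, comp (swapField h) p u v =ᶠ[𝓝 z]
        fun z => comp h p.swap u.swap v.swap z.swap := fun u v => by
      filter_upwards [(isOpen_extChartAt_target p).mem_nhds hz] with y hy
      exact comp_swapField h hy u v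
    have hswap : ∀ z : E₂ × E₁, HasFDerivAt Prod.swap
        ((ContinuousLinearMap.snd ℂ E₂ E₁).prod (ContinuousLinearMap.fst ℂ E₂ E₁)) z := fun z =>
      hasFDerivAt_snd.prodMk hasFDerivAt_fst
    rw [dBar_congr (hev e u), dHol_dBar_congr (hev u u), (hev e e).self_of_nhds,
      dBar_comp (hswap z) (hm.differentiableAt (hmem hz) _ _),
      dHol_dBar_comp hswap (hm.contDiffAt_two (hmem hz) _ _)]
    exact hc p.swap z.swap (hmem hz) u.swap v.swap e.swap

/-- In linear form, curvature nonpositivity passes to a submanifold simply by taking `u`, `v` and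
`e` tangent to it. -/
theorem restrictFst_mem_nonposMetrics {h : SesqField (𝓘(ℂ, E₁).prod 𝓘(ℂ, E₂)) (M₁ × M₂)}
    (hh : h ∈ nonposMetrics (𝓘(ℂ, E₁).prod 𝓘(ℂ, E₂)) (M₁ × M₂)) (y : M₂) :
    restrictFst y h ∈ nonposMetrics 𝓘(ℂ, E₁) M₁ := by
  rw [mem_nonposMetrics_iff] at hh ⊢
  obtain ⟨hm, hc⟩ := hh
  set w := extChartAt 𝓘(ℂ, E₂) y y with hw
  have hwt : w ∈ (extChartAt 𝓘(ℂ, E₂) y).target := mem_extChartAt_target y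
  have hmem : ∀ {p : M₁} {z : E₁}, z ∈ (extChartAt 𝓘(ℂ, E₁) p).target →
      (z, w) ∈ (extChartAt (𝓘(ℂ, E₁).prod 𝓘(ℂ, E₂)) (p, y)).target := fun hz =>
    mem_extChartAt_prod_target.mpr ⟨hz, hwt⟩
  have hcomp : ∀ {p : M₁} {z : E₁}, z ∈ (extChartAt 𝓘(ℂ, E₁) p).target → ∀ u v,
      comp (restrictFst y h) p u v z = comp h (p, y) (u, 0) (v, 0) (z, w) := fun hz u v => by
    have := comp_restrictFst h (hmem hz) u v
    rwa [hw, extChartAt_to_inv] at this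
  have hline : ∀ z : E₁, HasFDerivAt (fun z => (z, w)) (ContinuousLinearMap.inl ℂ E₁ E₂) z :=
    fun z => (hasFDerivAt_id z).prodMk (hasFDerivAt_const w z)
  refine ⟨⟨fun x U V => ?_, fun x U hU => ?_, fun p u v => ?_⟩, fun p z hz u v e => ?_⟩
  · exact hm.hermitian _ _ _
  · rw [restrictFst_apply]
    exact hm.pos _ _ fun h0 => hU (congrArg Prod.fst h0)
  · refine ContDiffOn.congr ?_ fun z hz => hcomp hz u v
    exact (hm.smooth (p, y) (u, 0) (v, 0)).comp (contDiff_prodMk_left w).contDiffOn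
      fun z hz => hmem hz
  · have hev : ∀ u v, comp (restrictFst y h) p u v =ᶠ[𝓝 z]
        fun z => comp h (p, y) (u, 0) (v, 0) (z, w) := fun u v => by
      filter_upwards [(isOpen_extChartAt_target p).mem_nhds hz] with x hx using hcomp hx u v
    rw [dBar_congr (hev e u), dHol_dBar_congr (hev u u), (hev e e).self_of_nhds,
      dBar_comp (hline z) (hm.differentiableAt (hmem hz) _ _),
      dHol_dBar_comp hline (hm.contDiffAt_two (hmem hz) _ _)]
    exact hc (p, y) (z, w) (hmem hz) (u, 0) (v, 0) (e, 0)

section Rigidity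

variable {h : SesqField (𝓘(ℂ, E₁).prod 𝓘(ℂ, E₂)) (M₁ × M₂)}

/-- The restriction of a nonpositively curved metric to the slices `M₁ × {y}` does not depend on
`y`. -/
theorem restrictFst_eq [CompactSpace M₂] [ConnectedSpace M₂]
    (hh : h ∈ nonposMetrics (𝓘(ℂ, E₁).prod 𝓘(ℂ, E₂)) (M₁ × M₂)) (y y' : M₂) :
    restrictFst y h = restrictFst y' h := by
  rw [mem_nonposMetrics_iff] at hh
  obtain ⟨hm, hc⟩ := hh
  funext x
  refine sesq_eq_of_diag fun U => ?_
  set z₁ := extChartAt 𝓘(ℂ, E₁) x x with hz₁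
  have hz₁t : z₁ ∈ (extChartAt 𝓘(ℂ, E₁) x).target := mem_extChartAt_target x
  have hmem : ∀ {p : M₂} {w : E₂}, w ∈ (extChartAt 𝓘(ℂ, E₂) p).target →
      (z₁, w) ∈ (extChartAt (𝓘(ℂ, E₁).prod 𝓘(ℂ, E₂)) (x, p)).target := fun hw =>
    mem_extChartAt_prod_target.mpr ⟨hz₁t, hw⟩
  -- `U` is written with constant coordinates `u` in the chart at `x`, valid for all points of `M₂`
  -- at once. The base point is generalized so that it can be replaced by its chart expression.
  obtain ⟨u, hu⟩ : ∃ u : E₁, ∀ p : M₂, ∀ w ∈ (extChartAt 𝓘(ℂ, E₂) p).target,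
      restrictFst ((extChartAt 𝓘(ℂ, E₂) p).symm w) h x U U
        = comp h (x, p) (u, 0) (u, 0) (z₁, w) := by
    have key : ∀ x', x' = x → ∀ U : TangentSpace 𝓘(ℂ, E₁) x',
        x' = (extChartAt 𝓘(ℂ, E₁) x).symm z₁ → ∃ u : E₁, ∀ p : M₂,
        ∀ w ∈ (extChartAt 𝓘(ℂ, E₂) p).target,
        restrictFst ((extChartAt 𝓘(ℂ, E₂) p).symm w) h x' U U
          = comp h (x, p) (u, 0) (u, 0) (z₁, w) := by
      rintro x' - U rfl
      obtain ⟨u, rfl⟩ := coordVec_surjective hz₁t U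
      exact ⟨u, fun p w hw => comp_restrictFst h (hmem hw) u u⟩
    exact key x rfl U (extChartAt_to_inv x).symm
  have hline : ∀ (w : E₂), HasFDerivAt (fun w => (z₁, w)) (ContinuousLinearMap.inr ℂ E₁ E₂) w :=
    fun w => (hasFDerivAt_const z₁ w).prodMk (hasFDerivAt_id w)
  obtain ⟨c, hconst⟩ := exists_re_eq_const_of_plurisubharmonic
    (f := fun y => (restrictFst y h x U U : ℂ))
    (fun p => by
      refine ContDiffOn.congr ?_ fun w hw => hu p w hw
      exact ((hm.smooth (x, p) (u, 0) (u, 0)).of_le (by norm_cast)).comp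
        (contDiff_prodMk_right z₁).contDiffOn fun w hw => hmem hw)
    (fun p w hw v => by
      have hev : (fun w => (restrictFst ((extChartAt 𝓘(ℂ, E₂) p).symm w) h x U U : ℂ)) =ᶠ[𝓝 w]
          fun w => comp h (x, p) (u, 0) (u, 0) (z₁, w) := by
        filter_upwards [(isOpen_extChartAt_target p).mem_nhds hw] with y hy using hu p y hy
      rw [dHol_dBar_congr hev, dHol_dBar_comp hline (hm.contDiffAt_two (hmem hw) _ _)]
      -- The test vector `e = 0` leaves exactly plurisubharmonicity along `M₂`.
      have := hc (x, p) (z₁, w) (hmem hw) (u, 0) (ContinuousLinearMap.inr ℂ E₁ E₂ v) 0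
      have h0 : ∀ v, comp h (x, p) 0 v = fun _ => 0 := fun v => funext fun z => by
        rw [← compForm_apply, map_zero, LinearMap.zero_apply]
      simpa [h0] using this)
  have him : ∀ y, (restrictFst y h x U U).im = 0 := fun y =>
    Complex.conj_eq_iff_im.mp (hm.hermitian (x, y) (U, 0) (U, 0)).symm
  exact Complex.ext ((hconst y).trans (hconst y').symm) ((him y).trans (him y').symm)

lemma eq_zero_of_forall_re_mul_le {b : ℂ} {S : ℝ} (hS : 0 ≤ S)
    (h : ∀ c : ℂ, 2 * (c * b).re ≤ ‖c‖ ^ 2 * S) : b = 0 := by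
  by_contra hb
  have hbn : 0 < ‖b‖ ^ 2 := by positivity
  -- For this `c` the inequality reads `2 t |b|² ≤ t² |b|² S` with `t = 1 / (1 + S)`, impossible
  -- since `t * S ≤ 1` unless `b = 0`.
  have h1 := h (((1 / (1 + S) : ℝ) : ℂ) * conj b)
  rw [mul_assoc, mul_comm (conj b) b, Complex.mul_conj, Complex.re_ofReal_mul, Complex.ofReal_re,
    Complex.normSq_eq_norm_sq, norm_mul, Complex.norm_real, Complex.norm_conj, mul_pow,
    Real.norm_of_nonneg (by positivity)] at h1
  have h2 : 2 * (1 / (1 + S) * ‖b‖ ^ 2) ≤ (S / (1 + S)) * (1 / (1 + S) * ‖b‖ ^ 2) := by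
    calc _ ≤ _ := h1
      _ = _ := by ring
  have h3 : S / (1 + S) ≤ 1 := by rw [div_le_one (by positivity)]; linarith
  have h4 : 0 < 1 / (1 + S) * ‖b‖ ^ 2 := by positivity
  nlinarith

/-- The components `h(e, u)` with `u` tangent to `M₁` are holomorphic along `M₂`. -/
theorem dBar_comp_eq_zero [CompactSpace M₂] [ConnectedSpace M₂]
    (hh : h ∈ nonposMetrics (𝓘(ℂ, E₁).prod 𝓘(ℂ, E₂)) (M₁ × M₂)) {p : M₁ × M₂} {z : E₁ × E₂}
    (hz : z ∈ (extChartAt (𝓘(ℂ, E₁).prod 𝓘(ℂ, E₂)) p).target) (u : E₁) (v : E₂) (e : E₁ × E₂) :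
    dBar (0, v) (comp h p e (u, 0)) z = 0 := by
  obtain ⟨hm, hc⟩ := mem_nonposMetrics_iff.mp hh
  obtain ⟨hz₁, hz₂⟩ := mem_extChartAt_prod_target.mp hz
  have hline : ∀ (w : E₂), HasFDerivAt (fun w => (z.1, w)) (ContinuousLinearMap.inr ℂ E₁ E₂) w :=
    fun w => (hasFDerivAt_const z.1 w).prodMk (hasFDerivAt_id w)
  have hzero : dHol (0, v) (dBar (0, v) (comp h p (u, 0) (u, 0))) z = 0 := by
    have h1 := dHol_dBar_comp hline (z := z.2) (hm.contDiffAt_two hz (u, 0) (u, 0)) v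
    have hev : (fun w => comp h p (u, 0) (u, 0) (z.1, w)) =ᶠ[𝓝 z.2]
        fun _ => comp h p (u, 0) (u, 0) z := by
      filter_upwards [(isOpen_extChartAt_target p.2).mem_nhds hz₂] with w hw
      have h2 := comp_restrictFst h (z := (z.1, w)) (mem_extChartAt_prod_target.mpr ⟨hz₁, hw⟩) u u
      rw [← h2, ← comp_restrictFst h hz u u, restrictFst_eq hh _
        ((extChartAt 𝓘(ℂ, E₂) p.2).symm z.2)]
    have h0 : dBar v (fun _ : E₂ => comp h p (u, 0) (u, 0) z) = fun _ => 0 :=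
      funext fun w => dBar_const v _ w
    rw [dHol_dBar_congr hev, h0, dHol_const] at h1
    exact h1.symm
  have hS : 0 ≤ (comp h p e e z).re := by
    by_cases he : e = 0
    · rw [he, ← compForm_apply, map_zero]
      exact le_rfl
    · exact (hm.comp_pos hz he).le
  refine eq_zero_of_forall_re_mul_le hS fun c => ?_
  -- The right-hand side is zero by rigidity of the slices; in `c • e` the left-hand side has a
  -- linear term in `c` that the quadratic one cannot absorb.
  have h1 := hc p z hz (u, 0) (0, v) (c • e)
  rw [hzero, comp_smul_smul_re, comp_smul_left, dBar_const_mul (hm.differentiableAt hz _ _)] at h1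
  simpa using h1

/-- The coefficients are real differentiable and satisfy the Cauchy–Riemann equations along `M₂` by
`dBar_comp_eq_zero`. -/
theorem mixedForm_mem_holomorphicOneForms [CompactSpace M₂] [ConnectedSpace M₂]
    (hh : h ∈ nonposMetrics (𝓘(ℂ, E₁).prod 𝓘(ℂ, E₂)) (M₁ × M₂)) (x : M₁)
    (U : TangentSpace 𝓘(ℂ, E₁) x) : mixedForm h x U ∈ holomorphicOneForms 𝓘(ℂ, E₂) M₂ := by
  have hm := hh.1
  intro p v
  set z₁ := extChartAt 𝓘(ℂ, E₁) x x with hz₁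
  have hz₁t : z₁ ∈ (extChartAt 𝓘(ℂ, E₁) x).target := mem_extChartAt_target x
  have hmem : ∀ {w : E₂}, w ∈ (extChartAt 𝓘(ℂ, E₂) p).target →
      (z₁, w) ∈ (extChartAt (𝓘(ℂ, E₁).prod 𝓘(ℂ, E₂)) (x, p)).target := fun hw =>
    mem_extChartAt_prod_target.mpr ⟨hz₁t, hw⟩
  have key : ∀ x', x' = (extChartAt 𝓘(ℂ, E₁) x).symm z₁ → ∀ U : TangentSpace 𝓘(ℂ, E₁) x',
      DifferentiableOn ℂ (formComp (mixedForm h x' U) p v) (extChartAt 𝓘(ℂ, E₂) p).target := by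
    rintro x' rfl U
    obtain ⟨u, rfl⟩ := coordVec_surjective hz₁t U
    refine DifferentiableOn.congr (f := fun w => comp h (x, p) (0, v) (u, 0) (z₁, w)) ?_
      fun w hw => formComp_mixedForm h (p := (x, p)) (z := (z₁, w)) (hmem hw) u v
    intro w hw
    have hline : HasFDerivAt (fun w => (z₁, w)) (ContinuousLinearMap.inr ℂ E₁ E₂) w :=
      (hasFDerivAt_const z₁ w).prodMk (hasFDerivAt_id w)
    have hd := hm.differentiableAt (hmem hw) (0, v) (u, 0)
    refine (differentiableAt_of_dBar_eq_zero
      (hd.comp w (hline.restrictScalars ℝ).differentiableAt) fun v' => ?_).differentiableWithinAt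
    exact (dBar_comp hline hd v').trans (dBar_comp_eq_zero hh (hmem hw) u v' _)
  exact key x (extChartAt_to_inv x).symm U

end Rigidity

end Product

end HermitianProduct

end

/-! ### Evaluation coordinates and the mixed part of the span -/

noncomputable section

namespace HermitianProduct

open Set Metric Filter Topology ComplexConjugate

/-- A finite-dimensional space with a separating family of linear forms has coordinates among these
forms. -/
lemma exists_coordinates {K V ι : Type*} [Field K] [AddCommGroup V] [Module K V] [Module.Finite K V]
    (ev : ι → Module.Dual K V) (hsep : ∀ v, (∀ i, ev i v = 0) → v = 0) :
    ∃ x : Fin (Module.finrank K V) → ι,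
      Function.Bijective (fun (v : V) (k : Fin (Module.finrank K V)) => ev (x k) v) := by
  obtain ⟨b, hb, hspan, hlin⟩ := exists_linearIndependent K (Set.range ev)
  have hfin : Finite b := hlin.finite
  have : Fintype b := Fintype.ofFinite b
  let L : V →ₗ[K] (b → K) := LinearMap.pi fun i => (i : Module.Dual K V)
  have hinj : Function.Injective L := by
    refine (injective_iff_map_eq_zero L).mpr fun v hv => hsep v fun i => ?_
    have h1 : Submodule.span K b ≤ LinearMap.ker (Module.Dual.eval K V v) :=
      Submodule.span_le.mpr fun f hf => congrFun hv ⟨f, hf⟩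
    rw [hspan] at h1
    exact h1 (Submodule.subset_span ⟨i, rfl⟩)
  -- Independence of the chosen forms gives one inequality, their separating vectors gives the
  -- other.
  have hcard : Fintype.card b = Module.finrank K V := by
    refine le_antisymm ?_ ?_
    · rw [← Subspace.dual_finrank_eq (K := K) (V := V)]
      exact hlin.fintype_card_le_finrank
    · simpa using LinearMap.finrank_le_finrank_of_injective hinj
  have hbij : Function.Bijective L := by
    refine ⟨hinj, (LinearMap.injective_iff_surjective_of_finrank_eq_finrank ?_).mp hinj⟩
    simp [hcard]
  let e : Fin (Module.finrank K V) ≃ b := (Fintype.equivFinOfCardEq hcard).symm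
  choose g hg using fun i : b => hb i.2
  refine ⟨fun k => g (e k), ?_⟩
  have h2 : (fun (v : V) (k : Fin (Module.finrank K V)) => ev (g (e k)) v)
      = (Equiv.arrowCongr e.symm (Equiv.refl K)) ∘ L := by
    funext v k
    rw [hg]
    rfl
  rw [h2]
  exact (Equiv.bijective _).comp hbij

/-- Evaluations at tangent vectors separate one-forms, so `h^{1,0}` of them can be chosen as
coordinates. -/
lemma exists_form_coordinates {E M : Type*} [NormedAddCommGroup E] [NormedSpace ℂ E]
    [TopologicalSpace M] [ChartedSpace E M] [Module.Finite ℂ (holomorphicOneForms 𝓘(ℂ, E) M)] :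
    ∃ x : Fin (hodge10 𝓘(ℂ, E) M) → Σ p : M, TangentSpace 𝓘(ℂ, E) p,
      (∀ φ ∈ holomorphicOneForms 𝓘(ℂ, E) M, (∀ k, φ (x k).1 (x k).2 = 0) → φ = 0) ∧
      ∀ c : Fin (hodge10 𝓘(ℂ, E) M) → ℂ, ∃ φ ∈ holomorphicOneForms 𝓘(ℂ, E) M,
        ∀ k, φ (x k).1 (x k).2 = c k := by
  let ev : (Σ p : M, TangentSpace 𝓘(ℂ, E) p) → Module.Dual ℂ (holomorphicOneForms 𝓘(ℂ, E) M) :=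
    fun q => ⟨⟨fun φ => φ.1 q.1 q.2, fun _ _ => rfl⟩, fun _ _ => rfl⟩
  obtain ⟨x, hx⟩ := exists_coordinates ev fun φ hφ =>
    Subtype.ext (funext fun p => LinearMap.ext fun u => hφ ⟨p, u⟩)
  refine ⟨x, fun φ hφ h0 => ?_, fun c => ?_⟩
  · have := hx.1 (a₁ := ⟨φ, hφ⟩) (a₂ := 0) (funext h0)
    exact congrArg Subtype.val this
  · obtain ⟨φ, hφ⟩ := hx.2 c
    exact ⟨φ.1, φ.2, fun k => congrFun hφ k⟩

section Product

variable {E₁ E₂ : Type*} [NormedAddCommGroup E₁] [NormedSpace ℂ E₁] [FiniteDimensional ℂ E₁]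
  [NormedAddCommGroup E₂] [NormedSpace ℂ E₂] [FiniteDimensional ℂ E₂]
  {M₁ M₂ : Type*} [TopologicalSpace M₁] [ChartedSpace E₁ M₁]
  [TopologicalSpace M₂] [ChartedSpace E₂ M₂]

section Spans

variable {h : SesqField (𝓘(ℂ, E₁).prod 𝓘(ℂ, E₂)) (M₁ × M₂)}

lemma hermitian_of_mem_productSpan (hh : h ∈ productSpan 𝓘(ℂ, E₁) 𝓘(ℂ, E₂) M₁ M₂)
    (q : M₁ × M₂) (U V : TangentSpace (𝓘(ℂ, E₁).prod 𝓘(ℂ, E₂)) q) :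
    h q U V = conj (h q V U) := by
  induction hh using Submodule.span_induction with
  | mem h hh => exact hh.1.hermitian q U V
  | zero => exact (map_zero _).symm
  | add h h' _ _ ih ih' =>
    change h q U V + h' q U V = conj (h q V U + h' q V U)
    rw [map_add, ih, ih']
  | smul r h _ ih =>
    change (r : ℂ) * h q U V = conj ((r : ℂ) * h q V U)
    rw [map_mul, Complex.conj_ofReal, ih]

lemma mixedForm_swapField (hh : h ∈ productSpan 𝓘(ℂ, E₁) 𝓘(ℂ, E₂) M₁ M₂) (x : M₁)
    (U : TangentSpace 𝓘(ℂ, E₁) x) (y : M₂) (V : TangentSpace 𝓘(ℂ, E₂) y) :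
    mixedForm (swapField h) y V x U = conj (mixedForm h x U y V) :=
  hermitian_of_mem_productSpan hh (x, y) (U, 0) (0, V)

variable [IsManifold 𝓘(ℂ, E₁) 1 M₁] [IsManifold 𝓘(ℂ, E₂) 1 M₂]

lemma mixedForm_mem_of_mem_productSpan [CompactSpace M₂] [ConnectedSpace M₂]
    (hh : h ∈ productSpan 𝓘(ℂ, E₁) 𝓘(ℂ, E₂) M₁ M₂) (x : M₁)
    (U : TangentSpace 𝓘(ℂ, E₁) x) : mixedForm h x U ∈ holomorphicOneForms 𝓘(ℂ, E₂) M₂ := by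
  induction hh using Submodule.span_induction with
  | mem h hh => exact mixedForm_mem_holomorphicOneForms hh x U
  | zero => exact zero_mem (holomorphicOneForms 𝓘(ℂ, E₂) M₂)
  | add h h' _ _ ih ih' => exact add_mem ih ih'
  | smul r h _ ih => exact Submodule.smul_mem _ (r : ℂ) ih

lemma mixedForm_swap_mem_of_mem_productSpan [CompactSpace M₁] [ConnectedSpace M₁]
    (hh : h ∈ productSpan 𝓘(ℂ, E₁) 𝓘(ℂ, E₂) M₁ M₂)
    (y : M₂) (V : TangentSpace 𝓘(ℂ, E₂) y) :
    mixedForm (swapField h) y V ∈ holomorphicOneForms 𝓘(ℂ, E₁) M₁ := by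
  induction hh using Submodule.span_induction with
  | mem h hh => exact mixedForm_mem_holomorphicOneForms (swapField_mem_nonposMetrics hh) y V
  | zero => exact zero_mem (holomorphicOneForms 𝓘(ℂ, E₁) M₁)
  | add h h' _ _ ih ih' => exact add_mem ih ih'
  | smul r h _ ih => exact Submodule.smul_mem _ (r : ℂ) ih

/-- Both restrictions of a generator lie in their cones, and a linear combination uses the same
coefficients in both slots, so the pair stays in the span of the product set. -/
lemma restrict_mem_span (hh : h ∈ productSpan 𝓘(ℂ, E₁) 𝓘(ℂ, E₂) M₁ M₂) (x : M₁) (y : M₂) :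
    (restrictFst y h, restrictSnd x h) ∈
      Submodule.span ℝ (nonposMetrics 𝓘(ℂ, E₁) M₁ ×ˢ nonposMetrics 𝓘(ℂ, E₂) M₂) := by
  have h1 : productSpan 𝓘(ℂ, E₁) 𝓘(ℂ, E₂) M₁ M₂ ≤ Submodule.comap
      ((restrictFst y).prod (restrictSnd x))
      (Submodule.span ℝ (nonposMetrics 𝓘(ℂ, E₁) M₁ ×ˢ nonposMetrics 𝓘(ℂ, E₂) M₂)) :=
    Submodule.span_le.mpr fun h hh => Submodule.subset_span
      ⟨restrictFst_mem_nonposMetrics hh y,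
        restrictFst_mem_nonposMetrics (swapField_mem_nonposMetrics hh) x⟩
  exact h1 hh

lemma restrictFst_eq_of_mem_productSpan [CompactSpace M₂] [ConnectedSpace M₂]
    (hh : h ∈ productSpan 𝓘(ℂ, E₁) 𝓘(ℂ, E₂) M₁ M₂)
    (y y' : M₂) : restrictFst y h = restrictFst y' h := by
  induction hh using Submodule.span_induction with
  | mem h hh => exact restrictFst_eq hh y y'
  | zero => rw [map_zero, map_zero]
  | add h h' _ _ ih ih' => rw [map_add, map_add, ih, ih']
  | smul r h _ ih => rw [map_smul, map_smul, ih]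

lemma restrictSnd_eq_of_mem_productSpan [CompactSpace M₁] [ConnectedSpace M₁]
    (hh : h ∈ productSpan 𝓘(ℂ, E₁) 𝓘(ℂ, E₂) M₁ M₂)
    (x x' : M₁) : restrictSnd x h = restrictSnd x' h := by
  induction hh using Submodule.span_induction with
  | mem h hh => exact restrictFst_eq (swapField_mem_nonposMetrics hh) x x'
  | zero => rw [map_zero, map_zero]
  | add h h' _ _ ih ih' => rw [map_add, map_add, ih, ih']
  | smul r h _ ih => rw [map_smul, map_smul, ih]

/-- The form splits into four blocks: the diagonal ones do not depend on the other factor by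
rigidity, and the two mixed ones are conjugate to each other, hence both zero. -/
lemma eq_productField_of_mixedForm_eq_zero [CompactSpace M₁] [ConnectedSpace M₁] [CompactSpace M₂] [ConnectedSpace M₂]
    (hh : h ∈ productSpan 𝓘(ℂ, E₁) 𝓘(ℂ, E₂) M₁ M₂)
    (hmix : ∀ x U y V, mixedForm h x U y V = 0) (x₀ : M₁) (y₀ : M₂) :
    productField 𝓘(ℂ, E₁) 𝓘(ℂ, E₂) M₁ M₂ (restrictFst y₀ h, restrictSnd x₀ h) = h := by
  funext q
  obtain ⟨x, y⟩ := q
  refine LinearMap.ext₂ fun U V => ?_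
  obtain ⟨U₁, U₂⟩ := U
  obtain ⟨V₁, V₂⟩ := V
  rw [restrictFst_eq_of_mem_productSpan hh y₀ y, restrictSnd_eq_of_mem_productSpan hh x₀ x]
  refine (productField_apply _ _ (x, y) (U₁, U₂) (V₁, V₂)).trans
    (Eq.trans ?_ (apply_eq_add h x y U₁ V₁ U₂ V₂).symm)
  have h1 : h (x, y) (0, U₂) (V₁, 0) = 0 := hmix x V₁ y U₂
  have h2 : h (x, y) (U₁, 0) (0, V₂) = 0 := by
    refine (mixedForm_swapField hh x U₁ y V₂).trans ?_
    exact (map_eq_zero _).mpr (hmix x U₁ y V₂)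
  rw [h1, h2, add_zero, zero_add]
  rfl

lemma mem_splitSpan_iff [CompactSpace M₁] [ConnectedSpace M₁] [CompactSpace M₂] [ConnectedSpace M₂]
    {ι κ : Type*} {X : ι → Σ p : M₁, TangentSpace 𝓘(ℂ, E₁) p}
    {Y : κ → Σ p : M₂, TangentSpace 𝓘(ℂ, E₂) p}
    (hX : ∀ φ ∈ holomorphicOneForms 𝓘(ℂ, E₁) M₁, (∀ k, φ (X k).1 (X k).2 = 0) → φ = 0)
    (hY : ∀ φ ∈ holomorphicOneForms 𝓘(ℂ, E₂) M₂, (∀ k, φ (Y k).1 (Y k).2 = 0) → φ = 0)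
    (hh : h ∈ productSpan 𝓘(ℂ, E₁) 𝓘(ℂ, E₂) M₁ M₂) :
    h ∈ splitSpan 𝓘(ℂ, E₁) 𝓘(ℂ, E₂) M₁ M₂ ↔ mixedEval X Y h = 0 := by
  constructor
  · rintro ⟨k, -, rfl⟩
    funext i j
    exact mixedForm_productField k _ _ _ _
  · intro h0
    -- Separation is used twice: first on `M₂` with each `X i` fixed, then on `M₁` for the conjugate
    -- forms, which now vanish at all `X i`.
    have h1 : ∀ i, mixedForm h (X i).1 (X i).2 = 0 := fun i =>
      hY _ (mixedForm_mem_of_mem_productSpan hh _ _) fun j => congrFun (congrFun h0 i) j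
    have h2 : ∀ y V, mixedForm (swapField h) y V = 0 := fun y V =>
      hX _ (mixedForm_swap_mem_of_mem_productSpan hh y V) fun i => by
        rw [mixedForm_swapField hh, h1 i]
        exact map_zero _
    have h3 : ∀ x U y V, mixedForm h x U y V = 0 := fun x U y V => by
      have := mixedForm_swapField hh x U y V
      rw [h2 y V] at this
      exact (map_eq_zero _).mp this.symm
    obtain ⟨x₀⟩ := (inferInstance : Nonempty M₁)
    obtain ⟨y₀⟩ := (inferInstance : Nonempty M₂)
    exact ⟨_, restrict_mem_span hh x₀ y₀, eq_productField_of_mixedForm_eq_zero hh h3 x₀ y₀⟩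

end Spans

variable [IsManifold 𝓘(ℂ, E₁) 1 M₁] [IsManifold 𝓘(ℂ, E₂) 1 M₂]

lemma exists_mixedForm_eq {h₁ : SesqField 𝓘(ℂ, E₁) M₁} {h₂ : SesqField 𝓘(ℂ, E₂) M₂}
    (hh₁ : h₁ ∈ nonposMetrics 𝓘(ℂ, E₁) M₁) (hh₂ : h₂ ∈ nonposMetrics 𝓘(ℂ, E₂) M₂)
    {φ : ∀ x : M₁, TangentSpace 𝓘(ℂ, E₁) x →ₗ[ℂ] ℂ}
    {ψ : ∀ y : M₂, TangentSpace 𝓘(ℂ, E₂) y →ₗ[ℂ] ℂ} (hφ : φ ∈ holomorphicOneForms 𝓘(ℂ, E₁) M₁)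
    (hψ : ψ ∈ holomorphicOneForms 𝓘(ℂ, E₂) M₂) :
    ∃ h ∈ productSpan 𝓘(ℂ, E₁) 𝓘(ℂ, E₂) M₁ M₂,
      ∀ x U y V, mixedForm h x U y V = ψ y V * conj (φ x U) :=
  ⟨_, sub_mem
    (Submodule.subset_span (add_rankOne_mem_nonposMetrics (prodForm_mem_holomorphicOneForms hφ hψ)
      (productField_mem_nonposMetrics hh₁ hh₂)))
    (Submodule.subset_span (productField_mem_nonposMetrics
      (add_rankOne_mem_nonposMetrics hφ hh₁) (add_rankOne_mem_nonposMetrics hψ hh₂))),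
    fun x U y V => sub_rankOne_apply_mixed h₁ h₂ φ ψ x y U V⟩

lemma exists_mixedEval_eq {ι κ : Type*} [Fintype ι] [Fintype κ]
    {X : ι → Σ p : M₁, TangentSpace 𝓘(ℂ, E₁) p} {Y : κ → Σ p : M₂, TangentSpace 𝓘(ℂ, E₂) p}
    (hX : ∀ c : ι → ℂ, ∃ φ ∈ holomorphicOneForms 𝓘(ℂ, E₁) M₁, ∀ k, φ (X k).1 (X k).2 = c k)
    (hY : ∀ c : κ → ℂ, ∃ φ ∈ holomorphicOneForms 𝓘(ℂ, E₂) M₂, ∀ k, φ (Y k).1 (Y k).2 = c k)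
    (hM₁ : (nonposMetrics 𝓘(ℂ, E₁) M₁).Nonempty) (hM₂ : (nonposMetrics 𝓘(ℂ, E₂) M₂).Nonempty)
    (c : ι → κ → ℂ) :
    ∃ h ∈ productSpan 𝓘(ℂ, E₁) 𝓘(ℂ, E₂) M₁ M₂, mixedEval X Y h = c := by
  classical
  obtain ⟨h₁, hh₁⟩ := hM₁
  obtain ⟨h₂, hh₂⟩ := hM₂
  -- The `φ i` are dual to the evaluations at `X`, and `ψ i` takes the values of row `c i`; the sum
  -- of the tensors `ψ i ⊗ conj (φ i)` then evaluates to `c`.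
  choose φ hφ hφX using fun i : ι => hX (Pi.single i 1)
  choose ψ hψ hψY using fun i : ι => hY (c i)
  choose k hk hkm using fun i : ι => exists_mixedForm_eq hh₁ hh₂ (hφ i) (hψ i)
  refine ⟨∑ i, k i, sum_mem fun i _ => hk i, ?_⟩
  rw [map_sum]
  funext i j
  rw [Finset.sum_apply, Finset.sum_apply, Finset.sum_eq_single i]
  · change mixedForm (k i) _ _ _ _ = _
    rw [hkm, hφX, hψY, Pi.single_eq_same, map_one, mul_one]
  · intro i' _ hne
    change mixedForm (k i') _ _ _ _ = _
    rw [hkm, hφX, Pi.single_eq_of_ne hne.symm, map_zero, mul_zero]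
  · exact fun hi => absurd (Finset.mem_univ i) hi

end Product

end HermitianProduct
end

/-! ### The dimension count -/

theorem mainTheorem2
    {E₁ E₂ : Type*}
    [NormedAddCommGroup E₁] [NormedSpace ℂ E₁] [FiniteDimensional ℂ E₁]
    [NormedAddCommGroup E₂] [NormedSpace ℂ E₂] [FiniteDimensional ℂ E₂]
    (M₁ M₂ : Type*)
    [TopologicalSpace M₁] [T2Space M₁] [CompactSpace M₁] [ConnectedSpace M₁]
    [ChartedSpace E₁ M₁] [IsManifold 𝓘(ℂ, E₁) ω M₁]
    [TopologicalSpace M₂] [T2Space M₂] [CompactSpace M₂] [ConnectedSpace M₂]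
    [ChartedSpace E₂ M₂] [IsManifold 𝓘(ℂ, E₂) ω M₂]
    (hM₁ : (HermitianProduct.nonposMetrics 𝓘(ℂ, E₁) M₁).Nonempty)
    (hM₂ : (HermitianProduct.nonposMetrics 𝓘(ℂ, E₂) M₂).Nonempty) :
    Function.Injective (HermitianProduct.productField 𝓘(ℂ, E₁) 𝓘(ℂ, E₂) M₁ M₂) ∧
    Set.MapsTo (HermitianProduct.productField 𝓘(ℂ, E₁) 𝓘(ℂ, E₂) M₁ M₂)
      (HermitianProduct.nonposMetrics 𝓘(ℂ, E₁) M₁ ×ˢ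
        HermitianProduct.nonposMetrics 𝓘(ℂ, E₂) M₂)
      (HermitianProduct.nonposMetrics (𝓘(ℂ, E₁).prod 𝓘(ℂ, E₂)) (M₁ × M₂)) ∧
    Module.Finite ℂ (HermitianProduct.holomorphicOneForms 𝓘(ℂ, E₁) M₁) ∧
    Module.Finite ℂ (HermitianProduct.holomorphicOneForms 𝓘(ℂ, E₂) M₂) ∧
    Module.Finite ℝ
      (HermitianProduct.productSpan 𝓘(ℂ, E₁) 𝓘(ℂ, E₂) M₁ M₂ ⧸
        (HermitianProduct.splitSpan 𝓘(ℂ, E₁) 𝓘(ℂ, E₂) M₁ M₂).submoduleOf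
          (HermitianProduct.productSpan 𝓘(ℂ, E₁) 𝓘(ℂ, E₂) M₁ M₂)) ∧
    Module.finrank ℝ
      (HermitianProduct.productSpan 𝓘(ℂ, E₁) 𝓘(ℂ, E₂) M₁ M₂ ⧸
        (HermitianProduct.splitSpan 𝓘(ℂ, E₁) 𝓘(ℂ, E₂) M₁ M₂).submoduleOf
          (HermitianProduct.productSpan 𝓘(ℂ, E₁) 𝓘(ℂ, E₂) M₁ M₂)) =
      2 * HermitianProduct.hodge10 𝓘(ℂ, E₁) M₁ * HermitianProduct.hodge10 𝓘(ℂ, E₂) M₂ := by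
  have hfin₁ : Module.Finite ℂ (HermitianProduct.holomorphicOneForms 𝓘(ℂ, E₁) M₁) :=
    HermitianProduct.finite_holomorphicOneForms hM₁.some_mem.1
  have hfin₂ : Module.Finite ℂ (HermitianProduct.holomorphicOneForms 𝓘(ℂ, E₂) M₂) :=
    HermitianProduct.finite_holomorphicOneForms hM₂.some_mem.1
  obtain ⟨X, hX, hX'⟩ := HermitianProduct.exists_form_coordinates (E := E₁) (M := M₁)
  obtain ⟨Y, hY, hY'⟩ := HermitianProduct.exists_form_coordinates (E := E₂) (M := M₂)
  -- `T` is onto the complex matrices of size `h^{1,0}(M₁) × h^{1,0}(M₂)` with kernel the split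
  -- span; the factor `2` is the real dimension of `ℂ`.
  let T := (HermitianProduct.mixedEval X Y).domRestrict
    (HermitianProduct.productSpan 𝓘(ℂ, E₁) 𝓘(ℂ, E₂) M₁ M₂)
  have hker : (HermitianProduct.splitSpan 𝓘(ℂ, E₁) 𝓘(ℂ, E₂) M₁ M₂).submoduleOf
      (HermitianProduct.productSpan 𝓘(ℂ, E₁) 𝓘(ℂ, E₂) M₁ M₂) = LinearMap.ker T := by
    ext h
    exact HermitianProduct.mem_splitSpan_iff hX hY h.2
  have hsurj : Function.Surjective T := fun c => by
    obtain ⟨h, hh, hc⟩ := HermitianProduct.exists_mixedEval_eq hX' hY' hM₁ hM₂ c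
    exact ⟨⟨h, hh⟩, hc⟩
  let e := (Submodule.quotEquivOfEq _ _ hker).trans (T.quotKerEquivOfSurjective hsurj)
  refine ⟨HermitianProduct.productField_injective,
    fun k hk => HermitianProduct.productField_mem_nonposMetrics hk.1 hk.2, hfin₁, hfin₂,
    Module.Finite.equiv e.symm, ?_⟩
  rw [e.finrank_eq]
  simp [Module.finrank_pi_fintype, Complex.finrank_real_complex]
  ring
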